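/- All graphs are finite. (Loops and parallel edges are allowed a priori, but a graph of girth at least five has neither.) A circuit has no repeated vertices; the girth of a graph is the length of its shortest circuit ($\infty$ if there is none); a graph is cubic if every vertex has degree three; a pentagon of $G$ is a subgraph of $G$ that is a circuit of length five. In a drawing of a graph in the plane, vertices are distinct points, each edge is a polygonal arc (a simple arc made of finitely many straight line segments) joining its ends and containing no other vertex, and two edges meet only in common ends; the faces are the connected components of the complement of the drawing. A graph $G$ is doublecross if it has four edges $e_1,e_2,e_3,e_4$, where $e_i$ has ends $u_i$ and $v_i$ for $i=1,2,3,4$, such that the graph $G\setminus\{e_1,e_2,e_3,e_4\}$ can be drawn in the plane with the unbounded face bounded by a circuit $C$ (that is, the boundary of the unbounded face is the point set of $C$), on which $u_1,u_2,v_1,v_2,u_3,u_4,v_3,v_4$ are pairwise distinct and occur in the order listed. Theorem. Every cubic doublecross graph of girth at least five has at least six pentagons. -/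

import Mathlib

namespace Doublecross

/-- The plane. Only its topology, its affine structure and its bounded sets are used below. -/
abbrev Plane : Type := ℝ × ℝ

/-- `A` is a polygonal arc with ends `x` and `y`: it is the union of `n ≥ 1` nondegenerate straight
line segments `[p 0, p 1], [p 1, p 2], …, [p (n - 1), p n]`, where `p 0 = x` and `p n = y`, such
that two of these segments meet only if they are consecutive, and then only in their common end. -/
def IsPolygonalArc (x y : Plane) (A : Set Plane) : Prop :=
  ∃ (n : ℕ) (p : Fin (n + 1) → Plane),
    0 < n ∧ p 0 = x ∧ p (Fin.last n) = y ∧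
    (∀ i : Fin n, p i.castSucc ≠ p i.succ) ∧
    (∀ i j : Fin n, i < j →
      ∀ z ∈ segment ℝ (p i.castSucc) (p i.succ), z ∈ segment ℝ (p j.castSucc) (p j.succ) →
        i.succ = j.castSucc ∧ z = p i.succ) ∧
    A = ⋃ i : Fin n, segment ℝ (p i.castSucc) (p i.succ)

/-- A drawing of the graph `H` in the plane (without crossings): distinct vertices are distinct
points, every edge is a polygonal arc joining its two ends, an edge contains no vertex other than
its ends, and two edges meet only in common ends. (The value of `arc` at a pair that is not an
edge of `H` plays no role.) -/
structure PlaneDrawing {V : Type*} (H : SimpleGraph V) where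
  pos : V → Plane
  arc : Sym2 V → Set Plane
  pos_injective : Function.Injective pos
  isPolygonalArc : ∀ a b : V, H.Adj a b → IsPolygonalArc (pos a) (pos b) (arc s(a, b))
  mem_of_pos_mem : ∀ e ∈ H.edgeSet, ∀ w : V, pos w ∈ arc e → w ∈ e
  arc_inter : ∀ e ∈ H.edgeSet, ∀ f ∈ H.edgeSet, e ≠ f →
    ∀ z ∈ arc e, z ∈ arc f → ∃ w : V, w ∈ e ∧ w ∈ f ∧ z = pos w

namespace PlaneDrawing

variable {V : Type*} {H : SimpleGraph V}

/-- The set of points of the plane occupied by the drawing. -/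
def carrier (D : PlaneDrawing H) : Set Plane :=
  Set.range D.pos ∪ ⋃ e ∈ H.edgeSet, D.arc e

/-- The faces of a drawing: the connected components of its complement in the plane. -/
def IsFace (D : PlaneDrawing H) (F : Set Plane) : Prop :=
  ∃ x ∈ D.carrierᶜ, F = connectedComponentIn D.carrierᶜ x

/-- The unbounded face of the drawing is bounded by the circuit that the closed walk `C` traverses:
its boundary is the union of the edges of `C`. -/
def OuterFaceBoundedBy (D : PlaneDrawing H) {a : V} (C : H.Walk a a) : Prop :=
  ∃ F : Set Plane, D.IsFace F ∧ ¬ Bornology.IsBounded F ∧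
    frontier F = ⋃ e ∈ {e | e ∈ C.edges}, D.arc e

end PlaneDrawing

/-- `G` is doublecross: it has four edges `e i = u i v i` (`i = 0, 1, 2, 3`) such that `G` with
these edges deleted can be drawn in the plane with the unbounded face bounded by a circuit `C`, on
which `u 0, u 1, v 0, v 1, u 2, u 3, v 2, v 3` are pairwise distinct and occur in the order listed.
The circuit is traversed starting from `u 0`. -/
def IsDoublecross {V : Type*} (G : SimpleGraph V) : Prop :=
  ∃ u v : Fin 4 → V,
    (∀ i, G.Adj (u i) (v i)) ∧
    [u 0, u 1, v 0, v 1, u 2, u 3, v 2, v 3].Nodup ∧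
    ∃ (D : PlaneDrawing (G.deleteEdges (Set.range fun i => s(u i, v i))))
      (C : (G.deleteEdges (Set.range fun i => s(u i, v i))).Walk (u 0) (u 0)),
      C.IsCycle ∧ D.OuterFaceBoundedBy C ∧
      [u 0, u 1, v 0, v 1, u 2, u 3, v 2, v 3].Sublist C.support

/-- A pentagon of `G`: a subgraph that is a circuit of length five. -/
def IsPentagon {V : Type*} (G : SimpleGraph V) (P : G.Subgraph) : Prop :=
  ∃ (a : V) (c : G.Walk a a), c.IsCycle ∧ c.length = 5 ∧ P = c.toSubgraph

end Doublecross

/-!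
Let `H` be the graph without the four crossing edges and `N T` the number of pentagons of `G` whose
set of edges outside `H` is `T`.

Euler's inequality bounds the number of faces of the drawing of `H` from below. It is obtained from
winding numbers: weights on the edges with boundary zero have a winding number about every point off
the drawing, constant on each face, and if it is the same on all faces then the weights vanish,
since the winding number jumps by the weight across an edge. So the cycle space, of dimension at
least `|E(H)| - |V| + 1`, embeds into the functions on the faces other than the outer one. The edges
across which the membership in a face changes form a set without leaves, because a small disc around
a vertex minus one radius is connected; hence this set contains a circuit, and has at least six
elements unless it is a pentagon. Since every edge has two sides and the outer face takes up `|C|`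
of them, this gives `|C| + 4 |E(H)| + 6 ≤ 6 |V| + N ∅`.

A pair of edges `e`, `f` crossing along `C`, with ends at the positions `i < j < k < l`, forms three
circuits with paths of `C`, of total length `2 (l - i) + 4`. Each has at least six edges unless it
is a pentagon, so `7 ≤ (l - i) + N {e} + N {f} + N {e, f}`. The two crossing pairs occupy disjoint
paths of `C`, whose lengths add up to at most `|C| - 2`. Altogether
`4 |E(G)| + 6 ≤ 6 |V| + (number of pentagons)`, where `4 |E(G)| = 6 |V|` if `G` is cubic.
-/

namespace Doublecross

open Filter Topology Set

section Saturated

/-- `A` is saturated with respect to `K` if it contains every connected set disjoint from `K` that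
it meets; off `K`, such a set is a union of connected components of the complement of `K`. -/
def IsSaturated {X : Type*} [TopologicalSpace X] (K A : Set X) : Prop :=
  ∀ s ⊆ Kᶜ, IsPreconnected s → (s ∩ A).Nonempty → s ⊆ A

variable {X : Type*} [TopologicalSpace X] {K A B U s : Set X}

theorem IsSaturated.union (hA : IsSaturated K A) (hB : IsSaturated K B) :
    IsSaturated K (A ∪ B) := by
  rintro s hsK hs ⟨z, hzs, hzA | hzB⟩
  · exact (hA s hsK hs ⟨z, hzs, hzA⟩).trans subset_union_left
  · exact (hB s hsK hs ⟨z, hzs, hzB⟩).trans subset_union_right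

theorem isSaturated_connectedComponentIn (x : X) :
    IsSaturated K (connectedComponentIn Kᶜ x) := by
  rintro s hsK hs ⟨z, hzs, hz⟩
  rw [connectedComponentIn_eq hz]
  exact hs.subset_connectedComponentIn hzs hsK

theorem compl_notMem_nhdsWithin {x : X} (hx : x ∈ closure s) (h : A ∈ 𝓝[s] x) :
    Aᶜ ∉ 𝓝[s] x := by
  have := mem_closure_iff_nhdsWithin_neBot.1 hx
  exact compl_notMem h

theorem mem_nhdsWithin_iff_of_isPreconnected (hU : IsPreconnected U) (hs : U ⊆ closure s)
    (h : ∀ y ∈ U, A ∈ 𝓝[s] y ∨ Aᶜ ∈ 𝓝[s] y) {x y : X} (hx : x ∈ U) (hy : y ∈ U) :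
    A ∈ 𝓝[s] x ↔ A ∈ 𝓝[s] y := by
  refine hU.induction₂ (fun x y => A ∈ 𝓝[s] x ↔ A ∈ 𝓝[s] y) (fun x hx => ?_)
    (fun _ _ _ _ _ _ => Iff.trans) (fun _ _ _ _ => Iff.symm) hx hy
  rcases h x hx with hA | hA
  · filter_upwards [nhdsWithin_le_nhds (eventually_nhds_nhdsWithin.2 hA)] with y hy
    exact iff_of_true hA hy
  · filter_upwards [nhdsWithin_le_nhds (eventually_nhds_nhdsWithin.2 hA),
      self_mem_nhdsWithin] with y hy hyU
    exact iff_of_false (fun h => compl_notMem_nhdsWithin (hs hx) h hA)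
      (fun h => compl_notMem_nhdsWithin (hs hyU) h hy)

theorem diff_subset_or_disjoint_of_isPreconnected (hU : IsPreconnected U) (hK : U ⊆ closure Kᶜ)
    (h : ∀ y ∈ U, A ∈ 𝓝[Kᶜ] y ∨ Aᶜ ∈ 𝓝[Kᶜ] y) : U \ K ⊆ A ∨ Disjoint (U \ K) A := by
  refine or_iff_not_imp_right.2 fun hd z hz => ?_
  obtain ⟨x, hx, hxA⟩ := not_disjoint_iff.1 hd
  have hAx : A ∈ 𝓝[Kᶜ] x :=
    (h x hx.1).resolve_right fun hAc => mem_of_mem_nhdsWithin hx.2 hAc hxA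
  exact mem_of_mem_nhdsWithin hz.2
    ((mem_nhdsWithin_iff_of_isPreconnected hU hK h hx.1 hz.1).1 hAx)

theorem IsSaturated.mem_nhdsWithin_or_compl_mem {E : Type*} [NormedAddCommGroup E]
    [NormedSpace ℝ E] {K A s : Set E} (hA : IsSaturated K A) (hs : Convex ℝ s) {x : E}
    (hx : Kᶜ ∈ 𝓝[s] x) : A ∈ 𝓝[s] x ∨ Aᶜ ∈ 𝓝[s] x := by
  obtain ⟨r, hr, hK⟩ := Metric.mem_nhdsWithin_iff.1 hx
  have hmem : Metric.ball x r ∩ s ∈ 𝓝[s] x :=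
    inter_mem (nhdsWithin_le_nhds (Metric.ball_mem_nhds x hr)) self_mem_nhdsWithin
  by_cases hne : ((Metric.ball x r ∩ s) ∩ A).Nonempty
  · exact .inl <| mem_of_superset hmem <|
      hA _ hK ((convex_ball x r).inter hs).isPreconnected hne
  · exact .inr <| mem_of_superset hmem fun z hz hzA => hne ⟨z, hz, hzA⟩

end Saturated

section BallDiffSegment

variable {E : Type*} [NormedAddCommGroup E] [NormedSpace ℝ E]

theorem sub_smul_notMem_ray (x : E) {v : E} (hv : v ≠ 0) {ε : ℝ} (hε : 0 < ε) :
    x - ε • v ∉ (fun t : ℝ => x + t • v) '' Ici 0 := by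
  rintro ⟨t, ht : 0 ≤ t, h⟩
  have hsum : (t + ε) • v = 0 := by linear_combination (norm := module) h
  rcases smul_eq_zero.1 hsum with h0 | h0
  · linarith
  · exact hv h0

theorem starConvex_compl_ray (x : E) {v : E} (hv : v ≠ 0) {ε : ℝ} (hε : 0 < ε) :
    StarConvex ℝ (x - ε • v) ((fun t : ℝ => x + t • v) '' Ici 0)ᶜ := by
  rw [starConvex_iff_forall_pos (sub_smul_notMem_ray x hv hε)]
  rintro w hw a b ha hb hab ⟨t, ht : 0 ≤ t, h⟩
  refine hw ⟨(t + a * ε) / b, div_nonneg (by positivity) hb.le, ?_⟩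
  have hbw : b • w = b • (x + ((t + a * ε) / b) • v) := by
    rw [smul_add, smul_smul, mul_div_cancel₀ _ hb.ne']
    obtain rfl : a = 1 - b := by linarith
    linear_combination (norm := module) (-1 : ℝ) • h
  exact (smul_right_injective E hb.ne' hbw).symm

theorem ball_diff_segment_eq {x y : E} {r : ℝ} (hr : r ≤ dist x y) :
    Metric.ball x r \ segment ℝ x y =
      Metric.ball x r ∩ ((fun t : ℝ => x + t • (y - x)) '' Ici 0)ᶜ := by
  refine Set.ext fun w => and_congr_right fun hw => not_congr ?_
  rw [segment_eq_image']
  refine ⟨fun ⟨t, ht, hw⟩ => ⟨t, ht.1, hw⟩, ?_⟩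
  rintro ⟨t, ht : 0 ≤ t, rfl⟩
  have hlt : t * dist x y < dist x y := by
    rw [mem_ball_iff_norm, add_sub_cancel_left, norm_smul, Real.norm_of_nonneg ht,
      ← dist_eq_norm, dist_comm y x] at hw
    exact hw.trans_le hr
  exact ⟨t, ⟨ht, by_contra fun h1 => hlt.not_ge
    (le_mul_of_one_le_left dist_nonneg (not_le.1 h1).le)⟩, rfl⟩

theorem isPreconnected_ball_diff_segment {x y : E} {r : ℝ} (hr : 0 < r) (hxy : r ≤ dist x y) :
    IsPreconnected (Metric.ball x r \ segment ℝ x y) := by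
  have hd : 0 < dist x y := hr.trans_le hxy
  have hne : y - x ≠ 0 := sub_ne_zero.2 (dist_pos.1 hd).symm
  have hε : 0 < r / (2 * dist x y) := by positivity
  have hcb : x - (r / (2 * dist x y)) • (y - x) ∈ Metric.ball x r := by
    rw [mem_ball_iff_norm, sub_sub_cancel_left, norm_neg, norm_smul, ← dist_eq_norm,
      dist_comm y x, Real.norm_of_nonneg hε.le]
    field_simp
    linarith
  rw [ball_diff_segment_eq hxy]
  have hstar := ((convex_ball x r).starConvex hcb).inter (starConvex_compl_ray x hne hε)
  exact (hstar.isPathConnected ⟨hcb, sub_smul_notMem_ray x hne hε⟩).isConnected.isPreconnected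

end BallDiffSegment

section HalfPlane

/-- Twice the signed area of the triangle `p q z`; it is positive to the left of the line `p q`. -/
def side (p q z : Plane) : ℝ := (q.1 - p.1) * (z.2 - p.2) - (q.2 - p.2) * (z.1 - p.1)

/-- The Euclidean inner product of `q - p` and `z - p`. -/
def along (p q z : Plane) : ℝ := (q.1 - p.1) * (z.1 - p.1) + (q.2 - p.2) * (z.2 - p.2)

/-- The open half-plane to the left (`0 < σ`) or to the right (`σ < 0`) of the line `p q`. -/
def halfPlane (p q : Plane) (σ : ℝ) : Set Plane := {z | 0 < σ * side p q z}

variable {p q x z : Plane} {σ : ℝ}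

theorem continuous_along (p q : Plane) : Continuous (along p q) := by
  unfold along
  fun_prop

theorem side_lineMap (p q : Plane) (t : ℝ) : side p q (AffineMap.lineMap p q t) = 0 := by
  simp only [side, AffineMap.lineMap_apply_module', Prod.fst_add, Prod.snd_add, Prod.smul_fst,
    Prod.smul_snd, Prod.fst_sub, Prod.snd_sub, smul_eq_mul]
  ring

theorem along_lineMap (p q : Plane) (t : ℝ) :
    along p q (AffineMap.lineMap p q t) = t * along p q q := by
  simp only [along, AffineMap.lineMap_apply_module', Prod.fst_add, Prod.snd_add, Prod.smul_fst,
    Prod.smul_snd, Prod.fst_sub, Prod.snd_sub, smul_eq_mul]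
  ring

theorem side_eq_zero_of_mem_segment (h : z ∈ segment ℝ p q) : side p q z = 0 := by
  rw [segment_eq_image_lineMap] at h
  obtain ⟨t, -, rfl⟩ := h
  exact side_lineMap p q t

theorem along_self_pos (h : p ≠ q) : 0 < along p q q := by
  have hne : q.1 - p.1 ≠ 0 ∨ q.2 - p.2 ≠ 0 := by
    by_contra! hc
    exact h (Prod.ext (by linarith [hc.1]) (by linarith [hc.2]))
  unfold along
  rcases hne with hne | hne
  · exact add_pos_of_pos_of_nonneg (mul_self_pos.2 hne) (mul_self_nonneg _)
  · exact add_pos_of_nonneg_of_pos (mul_self_nonneg _) (mul_self_pos.2 hne)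

theorem mem_openSegment_iff_side_along (h : p ≠ q) :
    z ∈ openSegment ℝ p q ↔ side p q z = 0 ∧ along p q z ∈ Ioo 0 (along p q q) := by
  have hpos := along_self_pos h
  rw [openSegment_eq_image_lineMap]
  constructor
  · rintro ⟨t, ⟨ht0, ht1⟩, rfl⟩
    rw [along_lineMap]
    exact ⟨side_lineMap p q t, mul_pos ht0 hpos, mul_lt_of_lt_one_left hpos ht1⟩
  · rintro ⟨hs, h0, h1⟩
    refine ⟨along p q z / along p q q, ⟨by positivity, (div_lt_one hpos).2 h1⟩, ?_⟩
    have hne := hpos.ne'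
    rw [AffineMap.lineMap_apply_module']
    ext <;> simp only [Prod.fst_add, Prod.snd_add, Prod.smul_fst, Prod.smul_snd, Prod.fst_sub,
      Prod.snd_sub, smul_eq_mul] <;> field_simp <;> simp only [side, along] at hs ⊢
    · linear_combination (q.2 - p.2) * hs
    · linear_combination -(q.1 - p.1) * hs

theorem convex_halfPlane (p q : Plane) (σ : ℝ) : Convex ℝ (halfPlane p q σ) := by
  have haff : IsLinearMap ℝ fun z : Plane =>
      σ * ((q.1 - p.1) * z.2 - (q.2 - p.2) * z.1) :=
    ⟨fun x y => by simp only [Prod.fst_add, Prod.snd_add]; ring,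
      fun c x => by simp only [Prod.smul_fst, Prod.smul_snd, smul_eq_mul]; ring⟩
  have heq : halfPlane p q σ = {z : Plane | σ * ((q.1 - p.1) * p.2 - (q.2 - p.2) * p.1) <
      σ * ((q.1 - p.1) * z.2 - (q.2 - p.2) * z.1)} := by
    ext z
    simp only [halfPlane, side, mem_ofPred_eq]
    rw [← sub_pos (b := σ * _)]
    ring_nf
  exact heq ▸ convex_halfSpace_gt haff _

theorem mem_closure_halfPlane (h : p ≠ q) (hx : side p q x = 0) (hσ : σ ≠ 0) :
    x ∈ closure (halfPlane p q σ) := by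
  have hlim : Tendsto (fun t : ℝ => x + t • ((-(σ * (q.2 - p.2)), σ * (q.1 - p.1)) : Plane))
      (𝓝[>] 0) (𝓝 x) := by
    refine ((Continuous.tendsto' (by fun_prop) 0 x (by simp)).mono_left nhdsWithin_le_nhds)
  refine mem_closure_of_tendsto hlim ?_
  filter_upwards [self_mem_nhdsWithin] with t (ht : 0 < t)
  have hside : σ * side p q (x + t • ((-(σ * (q.2 - p.2)), σ * (q.1 - p.1)) : Plane)) =
      t * (σ * σ) * along p q q := by
    simp only [side, along, Prod.fst_add, Prod.snd_add, Prod.smul_fst, Prod.smul_snd,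
      smul_eq_mul] at hx ⊢
    linear_combination σ * hx
  rw [halfPlane, mem_ofPred_eq, hside]
  exact mul_pos (mul_pos ht (mul_self_pos.2 hσ)) (along_self_pos h)

theorem halfPlane_one_union_halfPlane_neg_one (p q : Plane) :
    halfPlane p q 1 ∪ halfPlane p q (-1) = {z | side p q z ≠ 0} := by
  ext z
  simp only [halfPlane, mem_union, mem_ofPred_eq, one_mul, neg_one_mul, neg_pos]
  exact lt_or_lt_iff_ne.trans ne_comm

theorem eventually_mem_openSegment_iff_side_eq_zero (hx : x ∈ openSegment ℝ p q) (h : p ≠ q) :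
    ∀ᶠ z in 𝓝 x, z ∈ openSegment ℝ p q ↔ side p q z = 0 := by
  have hx' := ((mem_openSegment_iff_side_along h).1 hx).2
  filter_upwards [(continuous_along p q).continuousAt.preimage_mem_nhds
    (isOpen_Ioo.mem_nhds hx')] with z hz
  exact (mem_openSegment_iff_side_along h).trans (and_iff_left hz)

theorem isClosed_segment (p q : Plane) : IsClosed (segment ℝ p q) := by
  rw [segment_eq_image_lineMap]
  exact (isCompact_Icc.image (by fun_prop)).isClosed

end HalfPlane

/-- A family of nondegenerate straight line segments in the plane, with ends in a finite set of
nodes, such that no interior point of a segment is a node or lies on another segment. -/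
structure SegComplex (ι : Type*) where
  source : ι → Plane
  target : ι → Plane
  nodes : Set Plane
  finite_nodes : nodes.Finite
  source_mem : ∀ i, source i ∈ nodes
  target_mem : ∀ i, target i ∈ nodes
  source_ne_target : ∀ i, source i ≠ target i
  notMem_nodes : ∀ i, ∀ z ∈ openSegment ℝ (source i) (target i), z ∉ nodes
  notMem_segment : ∀ i j, i ≠ j → ∀ z ∈ openSegment ℝ (source i) (target i),
    z ∉ segment ℝ (source j) (target j)

namespace SegComplex

variable {ι : Type*} (S : SegComplex ι)

/-- The point set of a complex. -/
def carrier : Set Plane := S.nodes ∪ ⋃ i, segment ℝ (S.source i) (S.target i)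

/-- The closed segment with index `i`. -/
abbrev seg (i : ι) : Set Plane := segment ℝ (S.source i) (S.target i)

/-- The interior of the segment with index `i`. -/
abbrev openSeg (i : ι) : Set Plane := openSegment ℝ (S.source i) (S.target i)

/-- The open half-plane bounded by the line through the segment `i`, on the side of the sign of
`σ`. -/
abbrev half (i : ι) (σ : ℝ) : Set Plane := halfPlane (S.source i) (S.target i) σ

/-- The point `x` is an end of the segment `i`. -/
def Incident (i : ι) (x : Plane) : Prop := x = S.source i ∨ x = S.target i

/-- `A` separates the two sides of the segment `i`: near some interior point of the segment, the
points off the complex are neither all in `A` nor all outside `A`. -/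
def Jumps (A : Set Plane) (i : ι) : Prop :=
  ∃ x ∈ S.openSeg i, A ∉ 𝓝[S.carrierᶜ] x ∧ Aᶜ ∉ 𝓝[S.carrierᶜ] x

variable {S}

theorem side_eq_zero {i : ι} {x : Plane} (hx : x ∈ S.openSeg i) :
    side (S.source i) (S.target i) x = 0 :=
  side_eq_zero_of_mem_segment (openSegment_subset_segment _ _ _ hx)

theorem mem_closure_half {i : ι} {x : Plane} (hx : x ∈ S.openSeg i) {σ : ℝ} (hσ : σ ≠ 0) :
    x ∈ closure (S.half i σ) :=
  mem_closure_halfPlane (S.source_ne_target i) (side_eq_zero hx) hσ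

theorem exists_mem_openSeg {x : Plane} (hx : x ∈ S.carrier) (hxN : x ∉ S.nodes) :
    ∃ i, x ∈ S.openSeg i := by
  obtain ⟨i, hi⟩ := mem_iUnion.1 (hx.resolve_left hxN)
  exact ⟨i, mem_openSegment_of_ne_left_right (fun h => hxN (h ▸ S.source_mem i))
    (fun h => hxN (h ▸ S.target_mem i)) hi⟩

theorem Incident.mem_nodes {i : ι} {x : Plane} (hx : S.Incident i x) : x ∈ S.nodes := by
  rcases hx with rfl | rfl
  exacts [S.source_mem i, S.target_mem i]

theorem incident_of_mem_seg {i : ι} {x : Plane} (hx : x ∈ S.seg i) (hxN : x ∈ S.nodes) :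
    S.Incident i x := by
  by_contra h
  rw [Incident, not_or] at h
  exact S.notMem_nodes i x (mem_openSegment_of_ne_left_right (Ne.symm h.1) (Ne.symm h.2) hx) hxN

theorem Incident.exists_segment_eq {i : ι} {x : Plane} (hx : S.Incident i x) :
    ∃ y, x ≠ y ∧ segment ℝ x y = S.seg i ∧ openSegment ℝ x y = S.openSeg i := by
  rcases hx with rfl | rfl
  · exact ⟨_, S.source_ne_target i, rfl, rfl⟩
  · exact ⟨_, (S.source_ne_target i).symm, segment_symm _ _ _, openSegment_symm _ _ _⟩

theorem mem_nhdsWithin_or_compl_mem_of_not_jumps {A : Set Plane} {i : ι} (h : ¬ S.Jumps A i)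
    {x : Plane} (hx : x ∈ S.openSeg i) : A ∈ 𝓝[S.carrierᶜ] x ∨ Aᶜ ∈ 𝓝[S.carrierᶜ] x := by
  by_contra! hc
  exact h ⟨x, hx, hc⟩

theorem isPreconnected_compl_nodes (S : SegComplex ι) : IsPreconnected S.nodesᶜ := by
  refine (S.finite_nodes.countable.isConnected_compl_of_one_lt_rank ?_).isPreconnected
  rw [rank_prod', Module.rank_self, one_add_one_eq_two]
  exact_mod_cast one_lt_two

variable [Finite ι]

variable (S) in
theorem isClosed_carrier : IsClosed S.carrier :=
  S.finite_nodes.isClosed.union (isClosed_iUnion_of_finite fun _ => isClosed_segment _ _)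

theorem eventually_mem_carrier_iff {i : ι} {x : Plane} (hx : x ∈ S.openSeg i) :
    ∀ᶠ z in 𝓝 x, z ∈ S.carrier ↔ side (S.source i) (S.target i) z = 0 := by
  have hnodes : ∀ᶠ z in 𝓝 x, z ∉ S.nodes :=
    S.finite_nodes.isClosed.isOpen_compl.mem_nhds (S.notMem_nodes i x hx)
  have hother : ∀ᶠ z in 𝓝 x, ∀ j, i ≠ j → z ∉ S.seg j := by
    rw [eventually_all]
    refine fun j => eventually_imp_distrib_left.2 fun hj => ?_
    exact (isClosed_segment _ _).isOpen_compl.mem_nhds (S.notMem_segment i j hj x hx)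
  filter_upwards [hnodes, hother,
    eventually_mem_openSegment_iff_side_eq_zero hx (S.source_ne_target i)] with z hzN hzj hz
  rw [carrier, mem_union, or_iff_right hzN, mem_iUnion]
  refine ⟨fun ⟨j, hj⟩ => ?_, fun h => ⟨i, openSegment_subset_segment _ _ _ (hz.2 h)⟩⟩
  obtain rfl : i = j := by_contra fun hij => hzj j hij hj
  exact side_eq_zero_of_mem_segment hj

theorem nhdsWithin_compl_carrier {i : ι} {x : Plane} (hx : x ∈ S.openSeg i) :
    𝓝[S.carrierᶜ] x = 𝓝[S.half i 1] x ⊔ 𝓝[S.half i (-1)] x := by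
  rw [← nhdsWithin_union, halfPlane_one_union_halfPlane_neg_one, nhdsWithin_eq_iff_eventuallyEq]
  filter_upwards [eventually_mem_carrier_iff hx] with z hz using propext (not_congr hz)

theorem nhdsWithin_half_le {i : ι} {x : Plane} (hx : x ∈ S.openSeg i) (σ : ℝ) :
    𝓝[S.half i σ] x ≤ 𝓝[S.carrierᶜ] x := by
  refine nhdsWithin_le_iff.2 ?_
  filter_upwards [nhdsWithin_le_nhds (eventually_mem_carrier_iff hx), self_mem_nhdsWithin]
    with z hz (hzσ : 0 < σ * _) hzK
  rw [hz.1 hzK, mul_zero] at hzσ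
  exact hzσ.false

theorem mem_closure_compl_carrier {x : Plane} (hx : x ∉ S.nodes) : x ∈ closure S.carrierᶜ := by
  by_cases hxK : x ∈ S.carrier
  · obtain ⟨i, hi⟩ := exists_mem_openSeg hxK hx
    rw [mem_closure_iff_nhdsWithin_neBot]
    have := mem_closure_iff_nhdsWithin_neBot.1 (mem_closure_half hi one_ne_zero)
    exact this.mono (nhdsWithin_half_le hi 1)
  · exact subset_closure hxK

variable {A : Set Plane}

theorem mem_half_or_compl_mem_half (hA : IsSaturated S.carrier A) {i : ι} {x : Plane}
    (hx : x ∈ S.openSeg i) (σ : ℝ) :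
    A ∈ 𝓝[S.half i σ] x ∨ Aᶜ ∈ 𝓝[S.half i σ] x :=
  hA.mem_nhdsWithin_or_compl_mem (convex_halfPlane _ _ σ)
    (nhdsWithin_half_le hx σ self_mem_nhdsWithin)

theorem mem_half_iff_of_mem_openSeg (hA : IsSaturated S.carrier A) {i : ι} {x y : Plane}
    (hx : x ∈ S.openSeg i) (hy : y ∈ S.openSeg i) {σ : ℝ} (hσ : σ ≠ 0) :
    A ∈ 𝓝[S.half i σ] x ↔ A ∈ 𝓝[S.half i σ] y :=
  mem_nhdsWithin_iff_of_isPreconnected (convex_openSegment _ _).isPreconnected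
    (fun _ hz => mem_closure_half hz hσ) (fun _ hz => mem_half_or_compl_mem_half hA hz σ) hx hy

theorem jumps_iff (hA : IsSaturated S.carrier A) {i : ι} {x : Plane} (hx : x ∈ S.openSeg i) :
    S.Jumps A i ↔ ¬ (A ∈ 𝓝[S.half i 1] x ↔ A ∈ 𝓝[S.half i (-1)] x) := by
  have hlocal {y} (hy : y ∈ S.openSeg i) : A ∉ 𝓝[S.carrierᶜ] y ∧ Aᶜ ∉ 𝓝[S.carrierᶜ] y ↔
      ¬ (A ∈ 𝓝[S.half i 1] y ↔ A ∈ 𝓝[S.half i (-1)] y) := by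
    have hcompl {σ : ℝ} (hσ : σ ≠ 0) : Aᶜ ∈ 𝓝[S.half i σ] y ↔ A ∉ 𝓝[S.half i σ] y :=
      ⟨fun hc h => compl_notMem_nhdsWithin (mem_closure_half hy hσ) h hc,
        (mem_half_or_compl_mem_half hA hy _).resolve_left⟩
    rw [nhdsWithin_compl_carrier hy, mem_sup, mem_sup, hcompl one_ne_zero,
      hcompl (neg_ne_zero.2 one_ne_zero)]
    tauto
  refine ⟨fun ⟨y, hy, hj⟩ => ?_, fun h => ⟨x, hx, (hlocal hx).2 h⟩⟩
  rw [mem_half_iff_of_mem_openSeg hA hx hy one_ne_zero,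
    mem_half_iff_of_mem_openSeg hA hx hy (neg_ne_zero.2 one_ne_zero)]
  exact (hlocal hy).1 hj

theorem not_jumps_of_mem_nhdsWithin_or_compl_mem (hA : IsSaturated S.carrier A) {i : ι}
    {x : Plane} (hx : x ∈ S.openSeg i) (h : A ∈ 𝓝[S.carrierᶜ] x ∨ Aᶜ ∈ 𝓝[S.carrierᶜ] x) :
    ¬ S.Jumps A i := by
  rw [jumps_iff hA hx, not_not]
  rw [nhdsWithin_compl_carrier hx, mem_sup, mem_sup] at h
  rcases h with h | h
  · exact iff_of_true h.1 h.2
  · exact iff_of_false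
      (fun hA => compl_notMem_nhdsWithin (mem_closure_half hx one_ne_zero) hA h.1)
      (fun hA => compl_notMem_nhdsWithin (mem_closure_half hx (by norm_num)) hA h.2)

theorem diff_subset_or_disjoint {U : Set Plane} (hA : IsSaturated S.carrier A)
    (hU : IsPreconnected U) (hUN : Disjoint U S.nodes)
    (h : ∀ i, (U ∩ S.openSeg i).Nonempty → ¬ S.Jumps A i) :
    U \ S.carrier ⊆ A ∨ Disjoint (U \ S.carrier) A := by
  refine diff_subset_or_disjoint_of_isPreconnected hU
    (fun y hy => mem_closure_compl_carrier (disjoint_left.1 hUN hy)) fun y hy => ?_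
  by_cases hyK : y ∈ S.carrier
  · obtain ⟨i, hi⟩ := exists_mem_openSeg hyK (disjoint_left.1 hUN hy)
    exact mem_nhdsWithin_or_compl_mem_of_not_jumps (h i ⟨y, hy, hi⟩) hi
  · have hnhds : S.carrierᶜ ∈ 𝓝 y := S.isClosed_carrier.isOpen_compl.mem_nhds hyK
    rw [nhdsWithin_eq_nhds.2 hnhds, ← nhdsWithin_univ]
    exact hA.mem_nhdsWithin_or_compl_mem convex_univ (nhdsWithin_le_nhds hnhds)

theorem compl_subset_or_disjoint (hA : IsSaturated S.carrier A) (h : ∀ i, ¬ S.Jumps A i) :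
    S.carrierᶜ ⊆ A ∨ Disjoint S.carrierᶜ A := by
  have heq : S.nodesᶜ \ S.carrier = S.carrierᶜ :=
    inter_eq_right.2 (compl_subset_compl.2 subset_union_left)
  rw [← heq]
  exact diff_subset_or_disjoint hA S.isPreconnected_compl_nodes disjoint_compl_left
    fun i _ => h i

theorem exists_ball_inter_carrier {x : Plane} (hx : x ∈ S.nodes) :
    ∃ r > 0, (∀ z ∈ Metric.ball x r, z ∈ S.nodes → z = x) ∧
      ∀ i, (Metric.ball x r ∩ S.seg i).Nonempty → S.Incident i x := by
  have hnodes : ∀ᶠ z in 𝓝 x, z ∉ S.nodes \ {x} :=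
    (S.finite_nodes.subset sdiff_subset).isClosed.isOpen_compl.mem_nhds (by simp)
  have hsegs : ∀ᶠ z in 𝓝 x, ∀ i, x ∉ S.seg i → z ∉ S.seg i := by
    rw [eventually_all]
    exact fun i => eventually_imp_distrib_left.2 fun hi =>
      (isClosed_segment _ _).isOpen_compl.mem_nhds hi
  obtain ⟨r, hr, hball⟩ := Metric.eventually_nhds_iff_ball.1 (hnodes.and hsegs)
  refine ⟨r, hr, fun z hz hzN => by_contra fun hzx => (hball z hz).1 ⟨hzN, hzx⟩, ?_⟩
  rintro i ⟨z, hz, hzi⟩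
  exact incident_of_mem_seg (by_contra fun hxi => (hball z hz).2 i hxi hzi) hx

/-- A small disc around a node minus one radius is connected, so the last of the segments at the
node cannot be the only one across which the membership in `A` changes. -/
theorem exists_ne_jumps (hA : IsSaturated S.carrier A) {i : ι} {x : Plane}
    (hx : S.Incident i x) (hi : S.Jumps A i) : ∃ j ≠ i, S.Incident j x ∧ S.Jumps A j := by
  by_contra! h
  obtain ⟨y, hxy, hseg, hoseg⟩ := hx.exists_segment_eq
  obtain ⟨r', hr', hnode, hsegs⟩ := exists_ball_inter_carrier hx.mem_nodes
  have hball : Metric.ball x (min r' (dist x y)) ⊆ Metric.ball x r' :=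
    Metric.ball_subset_ball (min_le_left _ _)
  have hr : 0 < min r' (dist x y) := lt_min hr' (dist_pos.2 hxy)
  have htriv := diff_subset_or_disjoint hA
    (isPreconnected_ball_diff_segment hr (min_le_right _ _))
    (disjoint_left.2 fun z hz hzN =>
      hz.2 (hnode z (hball hz.1) hzN ▸ left_mem_segment ℝ x y)) ?_
  · obtain ⟨w, hwb, hw⟩ : (Metric.ball x (min r' (dist x y)) ∩ openSegment ℝ x y).Nonempty :=
      mem_closure_iff_nhds.1 (segment_subset_closure_openSegment (left_mem_segment ℝ x y)) _
        (Metric.ball_mem_nhds x hr)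
    have hnear : (Metric.ball x (min r' (dist x y)) \ segment ℝ x y) \ S.carrier ∈
        𝓝[S.carrierᶜ] w := by
      filter_upwards [nhdsWithin_le_nhds (Metric.isOpen_ball.mem_nhds hwb), self_mem_nhdsWithin]
        with z hz hzK
      exact ⟨⟨hz, fun hzs => hzK (.inr (mem_iUnion.2 ⟨i, hseg.subset hzs⟩))⟩, hzK⟩
    refine not_jumps_of_mem_nhdsWithin_or_compl_mem hA (hoseg ▸ hw) ?_ hi
    exact htriv.imp (mem_of_superset hnear) fun hd =>
      mem_of_superset hnear hd.subset_compl_right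
  · rintro j ⟨z, ⟨hzb, hzs⟩, hzj⟩
    refine h j ?_ (hsegs j ⟨z, hball hzb, openSegment_subset_segment _ _ _ hzj⟩)
    rintro rfl
    exact hzs (hseg ▸ openSegment_subset_segment _ _ _ hzj)

end SegComplex

section Angles

/-- The oriented angle, in `(-π, π]`, under which the segment from `p` to `q` is seen from `z`. -/
noncomputable def viewAngle (p q z : ℂ) : ℝ := Complex.arg ((q - z) / (p - z))

/-- The oriented angle, in `(-π, π]`, by which the ray towards `p` turns when the observer moves
from `z₀` to `z`. -/
noncomputable def turnAngle (p z₀ z : ℂ) : ℝ := Complex.arg ((p - z) / (p - z₀))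

variable {p q z z₀ : ℂ}

theorem viewAngle_eq_pi_iff (hp : z ≠ p) (hq : z ≠ q) :
    viewAngle p q z = Real.pi ↔ z ∈ segment ℝ p q := by
  have habs : |viewAngle p q z| = Real.pi ↔ viewAngle p q z = Real.pi := by
    have hlt : -Real.pi < viewAngle p q z := Complex.neg_pi_lt_arg _
    rw [abs_eq Real.pi_pos.le, or_iff_left hlt.ne']
  rw [← habs, viewAngle, ← Complex.angle_eq_abs_arg (sub_ne_zero.2 hq.symm) (sub_ne_zero.2 hp.symm)]
  change EuclideanGeometry.angle q z p = _ ↔ _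
  rw [EuclideanGeometry.angle_eq_pi_iff_sbtw, segment_symm, mem_segment_iff_wbtw]
  exact ⟨Sbtw.wbtw, fun h => ⟨h, hq, hp⟩⟩

theorem div_mem_slitPlane (hz : z ∉ segment ℝ p q) : (q - z) / (p - z) ∈ Complex.slitPlane := by
  have hp : z ≠ p := fun h => hz (h ▸ left_mem_segment ℝ p q)
  have hq : z ≠ q := fun h => hz (h ▸ right_mem_segment ℝ p q)
  rw [Complex.mem_slitPlane_iff_arg]
  exact ⟨fun h => hz ((viewAngle_eq_pi_iff hp hq).1 h),
    div_ne_zero (sub_ne_zero.2 hq.symm) (sub_ne_zero.2 hp.symm)⟩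

theorem continuousAt_sub_div_sub (hz : z ≠ p) :
    ContinuousAt (fun z => (q - z) / (p - z)) z :=
  (by fun_prop : ContinuousAt (fun z => q - z) z).div (by fun_prop) (sub_ne_zero.2 hz.symm)

theorem continuousAt_viewAngle (hz : z ∉ segment ℝ p q) : ContinuousAt (viewAngle p q) z :=
  (Complex.continuousAt_arg (div_mem_slitPlane hz)).comp
    (f := fun z => (q - z) / (p - z))
    (continuousAt_sub_div_sub fun h => hz (h ▸ left_mem_segment ℝ p q))

theorem turnAngle_self (p z₀ : ℂ) : turnAngle p z₀ z₀ = 0 := by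
  rcases eq_or_ne (p - z₀) 0 with h | h <;> simp [turnAngle, h]

theorem continuousAt_turnAngle (hz : z₀ ≠ p) : ContinuousAt (turnAngle p z₀) z₀ := by
  have h1 : (p - z₀) / (p - z₀) ∈ Complex.slitPlane := by
    rw [div_self (sub_ne_zero.2 hz.symm)]
    exact Complex.one_mem_slitPlane
  exact (Complex.continuousAt_arg h1).comp (f := fun z => (p - z) / (p - z₀)) (by fun_prop)

theorem eventually_eq_zero_of_coe_angle_eq_zero {X : Type*} [TopologicalSpace X] {f : X → ℝ}
    {x : X} (hf : ContinuousAt f x) (hx : f x = 0) (h : ∀ᶠ y in 𝓝 x, (f y : Real.Angle) = 0) :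
    ∀ᶠ y in 𝓝 x, f y = 0 := by
  have hnear : Ioo (-Real.pi) Real.pi ∈ 𝓝 (f x) :=
    isOpen_Ioo.mem_nhds (by rw [hx]; exact ⟨neg_lt_zero.2 Real.pi_pos, Real.pi_pos⟩)
  filter_upwards [h, hf hnear] with y hy hyI
  rw [← Real.Angle.toReal_coe_eq_self_iff_mem_Ioc.2 (Ioo_subset_Ioc_self hyI), hy,
    Real.Angle.toReal_zero]

/-- Modulo `2π` the angle of sight changes by the difference of the turns at its two ends, and off
the segment it varies continuously. -/
theorem eventually_viewAngle_eq (hz : z₀ ∉ segment ℝ p q) :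
    ∀ᶠ z in 𝓝 z₀,
      viewAngle p q z = viewAngle p q z₀ + (turnAngle q z₀ z - turnAngle p z₀ z) := by
  have hp : z₀ ≠ p := fun h => hz (h ▸ left_mem_segment ℝ p q)
  have hq : z₀ ≠ q := fun h => hz (h ▸ right_mem_segment ℝ p q)
  have hzero := eventually_eq_zero_of_coe_angle_eq_zero (x := z₀)
    (f := fun z => viewAngle p q z - viewAngle p q z₀ - (turnAngle q z₀ z - turnAngle p z₀ z))
    (((continuousAt_viewAngle hz).sub continuousAt_const).sub
      ((continuousAt_turnAngle hq).sub (continuousAt_turnAngle hp)))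
    (by simp only [turnAngle_self, sub_self]) ?_
  · filter_upwards [hzero] with z h
    linarith
  · filter_upwards [isOpen_ne.mem_nhds hp, isOpen_ne.mem_nhds hq] with z hzp hzq
    have hp₀ := sub_ne_zero.2 hp.symm
    have hq₀ := sub_ne_zero.2 hq.symm
    have hp₁ := sub_ne_zero.2 hzp.symm
    have hq₁ := sub_ne_zero.2 hzq.symm
    simp only [viewAngle, turnAngle, Real.Angle.coe_sub]
    rw [Complex.arg_div_coe_angle hq₁ hp₁, Complex.arg_div_coe_angle hq₀ hp₀,
      Complex.arg_div_coe_angle hq₁ hq₀, Complex.arg_div_coe_angle hp₁ hp₀]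
    abel

end Angles

section PlaneAngles

/-- The standard identification of the plane with the complex numbers. -/
noncomputable abbrev toC : Plane ≃L[ℝ] ℂ := Complex.equivRealProdCLM.symm

variable {p q x : Plane}

theorem toC_mem_segment_iff : toC x ∈ segment ℝ (toC p) (toC q) ↔ x ∈ segment ℝ p q := by
  have himage := image_segment ℝ (toC : Plane →ₗ[ℝ] ℂ).toAffineMap p q
  exact himage ▸ toC.injective.mem_set_image

theorem im_toC_div (p q z : Plane) : ((toC q - toC z) / (toC p - toC z)).im =
    side p q z / Complex.normSq (toC p - toC z) := by
  rw [Complex.div_im, ← sub_div]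
  congr 1
  simp only [toC, side, Complex.sub_re, Complex.sub_im, Complex.equivRealProdCLM_symm_apply_re,
    Complex.equivRealProdCLM_symm_apply_im]
  ring

theorem re_neg_and_im_eq_zero (hpq : p ≠ q) (hx : x ∈ openSegment ℝ p q) :
    ((toC q - toC x) / (toC p - toC x)).re < 0 ∧ ((toC q - toC x) / (toC p - toC x)).im = 0 := by
  have hxp : x ≠ p := by
    rintro rfl
    exact hpq (left_mem_openSegment_iff.1 hx)
  have hxq : x ≠ q := by
    rintro rfl
    exact hpq (right_mem_openSegment_iff.1 hx)
  rw [← Complex.arg_eq_pi_iff]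
  exact (viewAngle_eq_pi_iff (toC.injective.ne hxp) (toC.injective.ne hxq)).2
    (toC_mem_segment_iff.2 (openSegment_subset_segment _ _ _ hx))

theorem continuousAt_viewAngle_toC (hx : x ∉ segment ℝ p q) :
    ContinuousAt (fun z => viewAngle (toC p) (toC q) (toC z)) x :=
  (continuousAt_viewAngle (mt toC_mem_segment_iff.1 hx)).comp toC.continuous.continuousAt

theorem tendsto_div_halfPlane (hpq : p ≠ q) (hx : x ∈ openSegment ℝ p q) (σ : ℝ) :
    Tendsto (fun z => (toC q - toC z) / (toC p - toC z)) (𝓝[halfPlane p q σ] x)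
      (𝓝[{w | 0 < σ * w.im}] ((toC q - toC x) / (toC p - toC x))) := by
  have hxp : x ≠ p := by
    rintro rfl
    exact hpq (left_mem_openSegment_iff.1 hx)
  have hcont := (continuousAt_sub_div_sub (q := toC q) (toC.injective.ne hxp)).comp
    toC.continuous.continuousAt
  refine tendsto_nhdsWithin_iff.2 ⟨hcont.tendsto.mono_left nhdsWithin_le_nhds, ?_⟩
  filter_upwards [self_mem_nhdsWithin, nhdsWithin_le_nhds (isOpen_ne.mem_nhds hxp)]
    with z hz hzp
  have hpos : 0 < Complex.normSq (toC p - toC z) :=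
    Complex.normSq_pos.2 (sub_ne_zero.2 (toC.injective.ne hzp.symm))
  change 0 < σ * _
  rw [im_toC_div, ← mul_div_assoc]
  exact div_pos hz hpos

theorem tendsto_viewAngle_left (hpq : p ≠ q) (hx : x ∈ openSegment ℝ p q) :
    Tendsto (fun z => viewAngle (toC p) (toC q) (toC z)) (𝓝[halfPlane p q 1] x)
      (𝓝 Real.pi) := by
  obtain ⟨hre, him⟩ := re_neg_and_im_eq_zero hpq hx
  refine (Complex.tendsto_arg_nhdsWithin_im_nonneg_of_re_neg_of_im_zero hre him).comp
    ((tendsto_div_halfPlane hpq hx 1).mono_right (nhdsWithin_mono _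
      fun w (hw : 0 < 1 * w.im) => ?_))
  exact (one_mul w.im ▸ hw).le

theorem tendsto_viewAngle_right (hpq : p ≠ q) (hx : x ∈ openSegment ℝ p q) :
    Tendsto (fun z => viewAngle (toC p) (toC q) (toC z)) (𝓝[halfPlane p q (-1)] x)
      (𝓝 (-Real.pi)) := by
  obtain ⟨hre, him⟩ := re_neg_and_im_eq_zero hpq hx
  refine (Complex.tendsto_arg_nhdsWithin_im_neg_of_re_neg_of_im_zero hre him).comp
    ((tendsto_div_halfPlane hpq hx (-1)).mono_right (nhdsWithin_mono _
      fun w (hw : 0 < -1 * w.im) => ?_))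
  exact neg_pos.1 (neg_one_mul w.im ▸ hw)

end PlaneAngles

namespace SegComplex

variable {ι : Type*} (S : SegComplex ι) [Fintype ι]

/-- The total angle under which the segments, weighted by `f`, are seen from `z`: up to the
normalization, the winding number about `z` of the weighted complex. -/
noncomputable def wind (f : ι → ℝ) (z : Plane) : ℝ :=
  ∑ i, f i * viewAngle (toC (S.source i)) (toC (S.target i)) (toC z)

/-- The weights `f` form a cycle: they have boundary zero, when tested against functions on the
plane. -/
def IsBalanced (f : ι → ℝ) : Prop :=
  ∀ g : Plane → ℝ, ∑ i, f i * (g (S.target i) - g (S.source i)) = 0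

variable {S} {f : ι → ℝ}

theorem IsBalanced.eventually_wind_eq (hf : S.IsBalanced f) {z₀ : Plane} (hz : z₀ ∉ S.carrier) :
    ∀ᶠ z in 𝓝 z₀, S.wind f z₀ = S.wind f z := by
  have hview : ∀ᶠ z in 𝓝 z₀, ∀ i, viewAngle (toC (S.source i)) (toC (S.target i)) (toC z) =
      viewAngle (toC (S.source i)) (toC (S.target i)) (toC z₀) +
        (turnAngle (toC (S.target i)) (toC z₀) (toC z) -
          turnAngle (toC (S.source i)) (toC z₀) (toC z)) := by
    refine eventually_all.2 fun i => toC.continuous.continuousAt.eventually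
      (eventually_viewAngle_eq (mt toC_mem_segment_iff.1 fun h => ?_))
    exact hz (.inr (mem_iUnion.2 ⟨i, h⟩))
  filter_upwards [hview] with z h
  simp only [wind, h, mul_add, Finset.sum_add_distrib]
  rw [hf fun c => turnAngle (toC c) (toC z₀) (toC z), add_zero]

theorem IsBalanced.wind_eq_of_isPreconnected (hf : S.IsBalanced f) {T : Set Plane}
    (hT : IsPreconnected T) (hTK : T ⊆ S.carrierᶜ) {x y : Plane} (hx : x ∈ T) (hy : y ∈ T) :
    S.wind f x = S.wind f y :=
  hT.induction₂ (fun x y => S.wind f x = S.wind f y)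
    (fun _ hz => nhdsWithin_le_nhds (hf.eventually_wind_eq (hTK hz)))
    (fun _ _ _ _ _ _ => Eq.trans) (fun _ _ _ _ => Eq.symm) hx hy

theorem mul_add_sum_erase_eq_of_tendsto [DecidableEq ι] {c : ℝ}
    (h : ∀ z ∉ S.carrier, S.wind f z = c) {i : ι} {x : Plane} (hx : x ∈ S.openSeg i) {σ θ : ℝ}
    (hσ : σ ≠ 0)
    (hθ : Tendsto (fun z => viewAngle (toC (S.source i)) (toC (S.target i)) (toC z))
      (𝓝[S.half i σ] x) (𝓝 θ)) :
    f i * θ + ∑ j ∈ Finset.univ.erase i,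
      f j * viewAngle (toC (S.source j)) (toC (S.target j)) (toC x) = c := by
  have := mem_closure_iff_nhdsWithin_neBot.1 (mem_closure_half hx hσ)
  have hrest : ContinuousAt (fun z => ∑ j ∈ Finset.univ.erase i,
      f j * viewAngle (toC (S.source j)) (toC (S.target j)) (toC z)) x :=
    tendsto_finsetSum _ fun j hj => continuousAt_const.mul
      (continuousAt_viewAngle_toC (S.notMem_segment i j (Finset.ne_of_mem_erase hj).symm x hx))
  refine tendsto_nhds_unique
    ((hθ.const_mul (f i)).add (hrest.tendsto.mono_left nhdsWithin_le_nhds))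
    (tendsto_const_nhds.congr' ?_)
  filter_upwards [nhdsWithin_half_le hx σ self_mem_nhdsWithin] with z hz
  rw [← h z hz]
  exact (Finset.add_sum_erase _ _ (Finset.mem_univ i)).symm

/-- The total angle jumps by `2π` times the weight across a segment. -/
theorem weight_eq_zero_of_wind_eq {c : ℝ} (h : ∀ z ∉ S.carrier, S.wind f z = c) (i : ι) :
    f i = 0 := by
  classical
  have hm := midpoint_mem_openSegment (𝕜 := ℝ) (S.source i) (S.target i)
  have hleft := mul_add_sum_erase_eq_of_tendsto h hm one_ne_zero
    (tendsto_viewAngle_left (S.source_ne_target i) hm)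
  have hright := mul_add_sum_erase_eq_of_tendsto h hm (neg_ne_zero.2 one_ne_zero)
    (tendsto_viewAngle_right (S.source_ne_target i) hm)
  have hzero : f i * Real.pi = 0 := by linarith
  exact (mul_eq_zero.1 hzero).resolve_right Real.pi_ne_zero

end SegComplex

section Polyline

variable {E : Type*} [AddCommGroup E] [Module ℝ E]

/-- The polygonal line through `p 0, …, p n`. -/
def polyline (p : ℕ → E) (n : ℕ) : Set E := ⋃ k < n, segment ℝ (p k) (p (k + 1))

/-- The polygonal line through `p 0, …, p n` has nondegenerate segments and no self-intersection;
this is the condition on the vertices in `IsPolygonalArc`, with natural numbers as indices. -/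
structure IsSimplePolyline (p : ℕ → E) (n : ℕ) : Prop where
  ne_succ : ∀ k < n, p k ≠ p (k + 1)
  inter : ∀ i j, i < j → j < n → ∀ z ∈ segment ℝ (p i) (p (i + 1)),
    z ∈ segment ℝ (p j) (p (j + 1)) → i + 1 = j ∧ z = p (i + 1)

variable {p : ℕ → E} {n i j k : ℕ} {z : E}

theorem mem_polyline : z ∈ polyline p n ↔ ∃ k < n, z ∈ segment ℝ (p k) (p (k + 1)) := by
  simp only [polyline, mem_iUnion, exists_prop]

theorem vertex_mem_polyline (hn : 0 < n) (hk : k ≤ n) : p k ∈ polyline p n := by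
  rcases hk.lt_or_eq with h | rfl
  · exact mem_polyline.2 ⟨k, h, left_mem_segment _ _ _⟩
  · obtain ⟨m, rfl⟩ := Nat.exists_eq_succ_of_ne_zero hn.ne'
    exact mem_polyline.2 ⟨m, m.lt_succ_self, right_mem_segment _ _ _⟩

namespace IsSimplePolyline

theorem injOn (h : IsSimplePolyline p n) : InjOn p (Iic n) := by
  have hlt : ∀ i j, i < j → j ≤ n → p i ≠ p j := by
    intro i j hij hj heq
    obtain ⟨m, rfl⟩ := Nat.exists_eq_succ_of_ne_zero (Nat.ne_zero_of_lt hij)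
    rcases (Nat.le_of_lt_succ hij).lt_or_eq with him | rfl
    · obtain ⟨-, h'⟩ := h.inter i m him hj (p i) (left_mem_segment _ _ _)
        (heq ▸ right_mem_segment _ _ _)
      exact h.ne_succ i (by omega) h'
    · exact h.ne_succ i hj heq
  intro i hi j hj heq
  by_contra hij
  rcases Nat.lt_or_gt_of_ne hij with h' | h'
  · exact hlt i j h' hj heq
  · exact hlt j i h' hi heq.symm

theorem notMem_segment (h : IsSimplePolyline p n) (hi : i < n) (hj : j < n) (hij : i ≠ j)
    (hz : z ∈ openSegment ℝ (p i) (p (i + 1))) : z ∉ segment ℝ (p j) (p (j + 1)) := by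
  intro hz'
  have hzs := openSegment_subset_segment _ _ _ hz
  rcases Nat.lt_or_gt_of_ne hij with hlt | hlt
  · obtain ⟨-, rfl⟩ := h.inter i j hlt hj z hzs hz'
    exact h.ne_succ i hi (right_mem_openSegment_iff.1 hz)
  · obtain ⟨rfl, rfl⟩ := h.inter j i hlt hi z hz' hzs
    exact h.ne_succ _ hi (left_mem_openSegment_iff.1 hz)

theorem vertex_notMem_openSegment (h : IsSimplePolyline p n) (hk : k ≤ n) (hi : i < n) :
    p k ∉ openSegment ℝ (p i) (p (i + 1)) := by
  intro hz
  rcases eq_or_ne k i with rfl | hki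
  · exact h.ne_succ k hi (left_mem_openSegment_iff.1 hz)
  rcases hk.lt_or_eq with hkn | rfl
  · exact h.notMem_segment hi hkn hki.symm hz (left_mem_segment _ _ _)
  · obtain ⟨m, rfl⟩ := Nat.exists_eq_succ_of_ne_zero (Nat.ne_zero_of_lt hi)
    rcases eq_or_ne i m with rfl | him
    · exact h.ne_succ i hi (right_mem_openSegment_iff.1 hz)
    · exact h.notMem_segment hi m.lt_succ_self him hz (right_mem_segment _ _ _)

end IsSimplePolyline

end Polyline

theorem IsPolygonalArc.exists_polyline {x y : Plane} {A : Set Plane} (h : IsPolygonalArc x y A) :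
    ∃ (n : ℕ) (p : ℕ → Plane), 0 < n ∧ IsSimplePolyline p n ∧ p 0 = x ∧ p n = y ∧
      A = polyline p n := by
  obtain ⟨n, p, hn, rfl, rfl, hne, hinter, rfl⟩ := h
  have hleft (k) (hk : k < n) : p (Fin.ofNat (n + 1) k) = p (Fin.castSucc ⟨k, hk⟩) :=
    congrArg p (Fin.ext (Nat.mod_eq_of_lt (by omega)))
  have hright (k) (hk : k < n) : p (Fin.ofNat (n + 1) (k + 1)) = p (Fin.succ ⟨k, hk⟩) :=
    congrArg p (Fin.ext (Nat.mod_eq_of_lt (by omega)))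
  refine ⟨n, fun k => p (Fin.ofNat (n + 1) k), hn, ⟨fun k hk => ?_, fun i j hij hj => ?_⟩,
    rfl, congrArg p (Fin.ext (Nat.mod_eq_of_lt n.lt_succ_self)), ?_⟩
  · simp only [hleft k hk, hright k hk]
    exact hne _
  · simp only [hleft i (hij.trans hj), hright i (hij.trans hj), hleft j hj, hright j hj]
    intro z hzi hzj
    obtain ⟨hsucc, hz⟩ := hinter _ _ (Fin.mk_lt_mk.2 hij) z hzi hzj
    exact ⟨congrArg Fin.val hsucc, hz⟩
  · ext z
    rw [mem_iUnion, mem_polyline]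
    constructor
    · rintro ⟨k, hk⟩
      exact ⟨k, k.2, by rwa [hleft k k.2, hright k k.2]⟩
    · rintro ⟨k, hk, hz⟩
      rw [hleft k hk, hright k hk] at hz
      exact ⟨_, hz⟩

variable {V : Type*} {H : SimpleGraph V}

/-- No vertex lies on exactly one edge of `B`. -/
def IsLeafless (B : Set (Sym2 V)) : Prop := ∀ e ∈ B, ∀ v ∈ e, ∃ e' ∈ B, e' ≠ e ∧ v ∈ e'

/-- A choice, for every edge of a drawing, of an orientation and of the successive vertices of a
polygonal line that forms its arc. -/
structure Polygonization (D : PlaneDrawing H) where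
  tail : H.edgeSet → V
  head : H.edgeSet → V
  size : H.edgeSet → ℕ
  vertex : H.edgeSet → ℕ → Plane
  edge_eq : ∀ e, e.1 = s(tail e, head e)
  size_pos : ∀ e, 0 < size e
  simple : ∀ e, IsSimplePolyline (vertex e) (size e)
  vertex_zero : ∀ e, vertex e 0 = D.pos (tail e)
  vertex_size : ∀ e, vertex e (size e) = D.pos (head e)
  arc_eq : ∀ e, D.arc e.1 = polyline (vertex e) (size e)

theorem exists_polygonization (D : PlaneDrawing H) : Nonempty (Polygonization D) := by
  have h : ∀ e : H.edgeSet, ∃ (a b : V) (n : ℕ) (p : ℕ → Plane), e.1 = s(a, b) ∧ 0 < n ∧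
      IsSimplePolyline p n ∧ p 0 = D.pos a ∧ p n = D.pos b ∧ D.arc e.1 = polyline p n := by
    rintro ⟨e, he⟩
    induction e with | _ a b
    obtain ⟨n, p, h⟩ := (D.isPolygonalArc a b he).exists_polyline
    exact ⟨a, b, n, p, rfl, h⟩
  choose tail head size vertex edge_eq size_pos simple vertex_zero vertex_size arc_eq using h
  exact ⟨⟨tail, head, size, vertex, edge_eq, size_pos, simple, vertex_zero, vertex_size, arc_eq⟩⟩

namespace Polygonization

variable {D : PlaneDrawing H} (Γ : Polygonization D)

theorem vertex_mem_arc (e : H.edgeSet) {k : ℕ} (hk : k ≤ Γ.size e) :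
    Γ.vertex e k ∈ D.arc e.1 :=
  Γ.arc_eq e ▸ vertex_mem_polyline (Γ.size_pos e) hk

theorem segment_subset_arc (e : H.edgeSet) {k : ℕ} (hk : k < Γ.size e) :
    segment ℝ (Γ.vertex e k) (Γ.vertex e (k + 1)) ⊆ D.arc e.1 :=
  fun _ hz => Γ.arc_eq e ▸ mem_polyline.2 ⟨k, hk, hz⟩

theorem openSegment_subset_arc (e : H.edgeSet) {k : ℕ} (hk : k < Γ.size e) :
    openSegment ℝ (Γ.vertex e k) (Γ.vertex e (k + 1)) ⊆ D.arc e.1 :=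
  (openSegment_subset_segment _ _ _).trans (Γ.segment_subset_arc e hk)

theorem pos_eq_vertex {e : H.edgeSet} {v : V} (hv : v ∈ e.1) :
    D.pos v = Γ.vertex e 0 ∨ D.pos v = Γ.vertex e (Γ.size e) := by
  rw [Γ.edge_eq e, Sym2.mem_iff] at hv
  rw [Γ.vertex_zero, Γ.vertex_size]
  exact hv.imp (congrArg D.pos) (congrArg D.pos)

theorem eq_of_mem_arc {e e' : H.edgeSet} {z : Plane} (hz : z ∈ D.arc e.1) (hz' : z ∈ D.arc e'.1)
    (hzero : z ≠ Γ.vertex e 0) (hsize : z ≠ Γ.vertex e (Γ.size e)) : e' = e := by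
  by_contra hne
  obtain ⟨w, hw, -, rfl⟩ :=
    D.arc_inter e.1 e.2 e'.1 e'.2 (fun h => hne (Subtype.ext h.symm)) z hz hz'
  exact (Γ.pos_eq_vertex hw).elim hzero hsize

theorem ne_vertex_of_mem_openSegment {e : H.edgeSet} {i k : ℕ} (hi : i < Γ.size e)
    (hk : k ≤ Γ.size e) {z : Plane}
    (hz : z ∈ openSegment ℝ (Γ.vertex e i) (Γ.vertex e (i + 1))) : z ≠ Γ.vertex e k := by
  rintro rfl
  exact (Γ.simple e).vertex_notMem_openSegment hk hi hz

theorem eq_of_mem_openSegment {e e' : H.edgeSet} {i : ℕ} (hi : i < Γ.size e) {z : Plane}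
    (hz : z ∈ openSegment ℝ (Γ.vertex e i) (Γ.vertex e (i + 1))) (hz' : z ∈ D.arc e'.1) :
    e' = e :=
  Γ.eq_of_mem_arc (Γ.openSegment_subset_arc e hi hz) hz'
    (Γ.ne_vertex_of_mem_openSegment hi (Nat.zero_le _) hz)
    (Γ.ne_vertex_of_mem_openSegment hi le_rfl hz)

/-- The vertices of the drawing and of its polygonal lines. -/
def nodes : Set Plane :=
  range D.pos ∪ range fun x : Σ e, Fin (Γ.size e + 1) => Γ.vertex x.1 x.2

theorem notMem_nodes {e : H.edgeSet} {i : ℕ} (hi : i < Γ.size e) {z : Plane}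
    (hz : z ∈ openSegment ℝ (Γ.vertex e i) (Γ.vertex e (i + 1))) : z ∉ Γ.nodes := by
  rintro (⟨v, rfl⟩ | ⟨⟨e', k⟩, rfl⟩)
  · have hv := D.mem_of_pos_mem e.1 e.2 v (Γ.openSegment_subset_arc e hi hz)
    exact (Γ.pos_eq_vertex hv).elim (Γ.ne_vertex_of_mem_openSegment hi (Nat.zero_le _) hz)
      (Γ.ne_vertex_of_mem_openSegment hi le_rfl hz)
  · obtain rfl := Γ.eq_of_mem_openSegment hi hz (Γ.vertex_mem_arc e' (Nat.le_of_lt_succ k.2))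
    exact Γ.ne_vertex_of_mem_openSegment hi (Nat.le_of_lt_succ k.2) hz rfl

variable [Finite V]

/-- The segments of a drawing. -/
def complex : SegComplex (Σ e, Fin (Γ.size e)) where
  source x := Γ.vertex x.1 x.2
  target x := Γ.vertex x.1 (x.2 + 1)
  nodes := Γ.nodes
  finite_nodes := (finite_range _).union (finite_range _)
  source_mem x := .inr ⟨⟨x.1, x.2.castSucc⟩, rfl⟩
  target_mem x := .inr ⟨⟨x.1, x.2.succ⟩, rfl⟩
  source_ne_target x := (Γ.simple x.1).ne_succ x.2 x.2.2
  notMem_nodes x _ hz := Γ.notMem_nodes x.2.2 hz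
  notMem_segment := by
    rintro ⟨e, i⟩ ⟨e', j⟩ hne z hz hz'
    obtain rfl := Γ.eq_of_mem_openSegment i.2 hz (Γ.segment_subset_arc e' j.2 hz')
    have hij : (i : ℕ) ≠ j := fun h => hne (by rw [Fin.ext h])
    exact (Γ.simple e').notMem_segment i.2 j.2 hij hz hz'

theorem carrier_complex : Γ.complex.carrier = D.carrier := by
  ext z
  simp only [SegComplex.carrier, PlaneDrawing.carrier, complex, nodes, mem_union, mem_iUnion]
  constructor
  · rintro ((h | ⟨⟨e, k⟩, rfl⟩) | ⟨⟨e, k⟩, h⟩)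
    · exact .inl h
    · exact .inr ⟨e.1, e.2, Γ.vertex_mem_arc e (Nat.le_of_lt_succ k.2)⟩
    · exact .inr ⟨e.1, e.2, Γ.segment_subset_arc e k.2 h⟩
  · rintro (h | ⟨e, he, h⟩)
    · exact .inl (.inl h)
    · obtain ⟨k, hk, hz⟩ := mem_polyline.1 (Γ.arc_eq ⟨e, he⟩ ▸ h)
      exact .inr ⟨⟨⟨e, he⟩, ⟨k, hk⟩⟩, hz⟩

theorem incident_vertex_iff {e : H.edgeSet} {j : Fin (Γ.size e)} {k : ℕ} (hk : k ≤ Γ.size e) :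
    Γ.complex.Incident ⟨e, j⟩ (Γ.vertex e k) ↔ k = j ∨ k = j + 1 :=
  or_congr ((Γ.simple e).injOn.eq_iff hk j.2.le) ((Γ.simple e).injOn.eq_iff hk j.2)

theorem mem_arc_of_incident {x : Σ e, Fin (Γ.size e)} {z : Plane}
    (h : Γ.complex.Incident x z) : z ∈ D.arc x.1.1 := by
  rcases h with rfl | rfl
  exacts [Γ.vertex_mem_arc x.1 x.2.2.le, Γ.vertex_mem_arc x.1 x.2.2]

theorem exists_incident_pos {e : H.edgeSet} {v : V} (hv : v ∈ e.1) :
    ∃ i, Γ.complex.Incident ⟨e, i⟩ (D.pos v) ∧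
      ∀ j, Γ.complex.Incident ⟨e, j⟩ (D.pos v) → j = i := by
  have hpos := Γ.size_pos e
  rcases Γ.pos_eq_vertex hv with h | h <;> rw [h]
  · refine ⟨⟨0, hpos⟩, (Γ.incident_vertex_iff hpos.le).2 (.inl rfl), fun j hj => Fin.ext ?_⟩
    have := (Γ.incident_vertex_iff hpos.le).1 hj
    simp only
    omega
  · refine ⟨⟨Γ.size e - 1, by omega⟩, (Γ.incident_vertex_iff le_rfl).2 (.inr ?_),
      fun j hj => Fin.ext ?_⟩
    · simp only
      omega
    · have := (Γ.incident_vertex_iff le_rfl).1 hj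
      simp only
      omega

theorem eq_of_incident_vertex_succ {e : H.edgeSet} {k : ℕ} (hk : k + 1 < Γ.size e)
    {x : Σ e, Fin (Γ.size e)} (hx : Γ.complex.Incident x (Γ.vertex e (k + 1))) :
    x = ⟨e, ⟨k, by omega⟩⟩ ∨ x = ⟨e, ⟨k + 1, hk⟩⟩ := by
  obtain ⟨e', j⟩ := x
  obtain rfl : e' = e := by
    refine Γ.eq_of_mem_arc (Γ.vertex_mem_arc e hk.le) (Γ.mem_arc_of_incident hx) (fun h => ?_)
      (fun h => ?_)
    · exact absurd ((Γ.simple e).injOn hk.le (Nat.zero_le _) h) (by omega)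
    · exact absurd ((Γ.simple e).injOn hk.le self_mem_Iic h) (by omega)
  rcases (Γ.incident_vertex_iff hk.le).1 hx with h | h
  · exact .inr (congrArg _ (Fin.ext h.symm))
  · exact .inl (congrArg _ (Fin.ext (by simp only; omega)))

/-- The edges of the drawing across which membership in `A` changes. -/
def boundary (A : Set Plane) : Set (Sym2 V) := {e | ∃ x, Γ.complex.Jumps A x ∧ x.1.1 = e}

variable {A : Set Plane}

theorem boundary_subset_edgeSet (A : Set Plane) : Γ.boundary A ⊆ H.edgeSet := by
  rintro _ ⟨x, -, rfl⟩
  exact x.1.2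

theorem jumps_succ_iff (hA : IsSaturated Γ.complex.carrier A) {e : H.edgeSet} {k : ℕ}
    (hk : k + 1 < Γ.size e) :
    Γ.complex.Jumps A ⟨e, ⟨k + 1, hk⟩⟩ ↔ Γ.complex.Jumps A ⟨e, ⟨k, by omega⟩⟩ := by
  constructor <;> intro h
  · obtain ⟨x, hne, hx, hj⟩ :=
      SegComplex.exists_ne_jumps hA ((Γ.incident_vertex_iff hk.le).2 (.inl rfl)) h
    exact (Γ.eq_of_incident_vertex_succ hk hx).resolve_right hne ▸ hj
  · obtain ⟨x, hne, hx, hj⟩ :=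
      SegComplex.exists_ne_jumps hA ((Γ.incident_vertex_iff hk.le).2 (.inr rfl)) h
    exact (Γ.eq_of_incident_vertex_succ hk hx).resolve_left hne ▸ hj

theorem jumps_iff_jumps_zero (hA : IsSaturated Γ.complex.carrier A) (e : H.edgeSet)
    (k : Fin (Γ.size e)) :
    Γ.complex.Jumps A ⟨e, k⟩ ↔ Γ.complex.Jumps A ⟨e, ⟨0, Γ.size_pos e⟩⟩ := by
  obtain ⟨k, hk⟩ := k
  induction k with
  | zero => rfl
  | succ k ih => exact (Γ.jumps_succ_iff hA hk).trans (ih (by omega))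

theorem jumps_iff_mem_boundary (hA : IsSaturated Γ.complex.carrier A)
    (x : Σ e, Fin (Γ.size e)) : Γ.complex.Jumps A x ↔ x.1.1 ∈ Γ.boundary A := by
  refine ⟨fun h => ⟨x, h, rfl⟩, fun ⟨⟨e, j⟩, hj, he⟩ => ?_⟩
  obtain ⟨e', k⟩ := x
  obtain rfl : e = e' := Subtype.ext he
  exact (Γ.jumps_iff_jumps_zero hA e k).2 ((Γ.jumps_iff_jumps_zero hA e j).1 hj)

theorem isLeafless_boundary (hA : IsSaturated Γ.complex.carrier A) :
    IsLeafless (Γ.boundary A) := by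
  intro e he v hv
  lift e to H.edgeSet using Γ.boundary_subset_edgeSet A he
  obtain ⟨i, hi, hunique⟩ := Γ.exists_incident_pos hv
  obtain ⟨⟨e', j⟩, hne, hx, hj⟩ :=
    SegComplex.exists_ne_jumps hA hi ((Γ.jumps_iff_mem_boundary hA ⟨e, i⟩).2 he)
  refine ⟨e', ⟨_, hj, rfl⟩, fun hee' => hne ?_,
    D.mem_of_pos_mem e'.1 e'.2 v (Γ.mem_arc_of_incident hx)⟩
  obtain rfl : e' = e := Subtype.ext hee'
  rw [hunique j hx]

theorem compl_subset_or_disjoint_of_boundary_eq_empty (hA : IsSaturated Γ.complex.carrier A)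
    (h : Γ.boundary A = ∅) :
    Γ.complex.carrierᶜ ⊆ A ∨ Disjoint Γ.complex.carrierᶜ A :=
  SegComplex.compl_subset_or_disjoint hA fun x hx =>
    h.le ((Γ.jumps_iff_mem_boundary hA x).1 hx)

end Polygonization

section BoundaryMap

variable (K : Type*) [Field K] {E V : Type*} [Fintype E] [DecidableEq V] (tail head : E → V)

/-- The boundary operator of the directed graph whose arcs `e` run from `tail e` to `head e`; its
kernel is the cycle space. -/
def boundaryMap : (E → K) →ₗ[K] V → K :=
  Fintype.linearCombination K fun e => Pi.single (head e) 1 - Pi.single (tail e) 1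

variable {K}

theorem sum_boundaryMap_mul [Fintype V] (f : E → K) (g : V → K) :
    ∑ v, boundaryMap K tail head f v * g v = ∑ e, f e * (g (head e) - g (tail e)) := by
  simp only [boundaryMap, Fintype.linearCombination_apply, Finset.sum_apply, Pi.smul_apply,
    Pi.sub_apply, smul_eq_mul, Finset.sum_mul]
  rw [Finset.sum_comm]
  refine Finset.sum_congr rfl fun e _ => ?_
  simp only [mul_assoc, sub_mul, ← Finset.mul_sum, Finset.sum_sub_distrib, Pi.single_apply,
    ite_mul, one_mul, zero_mul, Finset.sum_ite_eq', Finset.mem_univ, if_true]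

theorem range_boundaryMap_lt_top [Finite V] [Nonempty V] :
    LinearMap.range (boundaryMap K tail head) < ⊤ := by
  have := Fintype.ofFinite V
  refine lt_top_iff_ne_top.2 fun htop => ?_
  obtain ⟨v⟩ := ‹Nonempty V›
  obtain ⟨f, hf⟩ := LinearMap.range_eq_top.1 htop (Pi.single v 1)
  have h := sum_boundaryMap_mul tail head f fun _ => 1
  simp only [hf, mul_one, sub_self, mul_zero, Finset.sum_const_zero] at h
  rw [Finset.sum_pi_single', if_pos (Finset.mem_univ v)] at h
  exact one_ne_zero h

theorem card_add_one_le_finrank_ker_boundaryMap [Fintype V] [Nonempty V] :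
    Fintype.card E + 1 ≤
      Module.finrank K (LinearMap.ker (boundaryMap K tail head)) + Fintype.card V := by
  have hsum := LinearMap.finrank_range_add_finrank_ker (boundaryMap K tail head)
  have hlt := Submodule.finrank_lt (range_boundaryMap_lt_top (K := K) tail head).ne
  rw [Module.finrank_fintype_fun_eq_card] at hsum hlt
  omega

end BoundaryMap

variable {V : Type*} {H : SimpleGraph V} {D : PlaneDrawing H}

namespace PlaneDrawing.IsFace

variable {F F' : Set Plane}

theorem isSaturated (hF : D.IsFace F) : IsSaturated D.carrier F := by
  obtain ⟨x, -, rfl⟩ := hF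
  exact isSaturated_connectedComponentIn x

theorem nonempty (hF : D.IsFace F) : F.Nonempty := by
  obtain ⟨x, hx, rfl⟩ := hF
  exact ⟨x, mem_connectedComponentIn hx⟩

theorem subset_compl (hF : D.IsFace F) : F ⊆ D.carrierᶜ := by
  obtain ⟨x, -, rfl⟩ := hF
  exact connectedComponentIn_subset _ _

theorem isPreconnected (hF : D.IsFace F) : IsPreconnected F := by
  obtain ⟨x, -, rfl⟩ := hF
  exact isPreconnected_connectedComponentIn

theorem eq_of_mem (hF : D.IsFace F) (hF' : D.IsFace F') {z : Plane} (hz : z ∈ F)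
    (hz' : z ∈ F') : F = F' := by
  obtain ⟨x, -, rfl⟩ := hF
  obtain ⟨y, -, rfl⟩ := hF'
  rw [connectedComponentIn_eq hz, connectedComponentIn_eq hz']

end PlaneDrawing.IsFace

namespace Polygonization

variable (Γ : Polygonization D) [Finite V]

section Wind

variable [Fintype H.edgeSet]

/-- The winding number, not normalized, of a weight on the edges about the point `z`. -/
noncomputable def windMap (z : Plane) : (H.edgeSet → ℝ) →ₗ[ℝ] ℝ where
  toFun f := Γ.complex.wind (fun x => f x.1) z
  map_add' f g := by simp only [SegComplex.wind, Pi.add_apply, add_mul, Finset.sum_add_distrib]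
  map_smul' c f := by
    simp only [SegComplex.wind, Pi.smul_apply, smul_eq_mul, Finset.mul_sum, mul_assoc,
      RingHom.id_apply]

variable {f : H.edgeSet → ℝ}

theorem eq_zero_of_windMap_eq {c : ℝ} (h : ∀ z ∉ D.carrier, Γ.windMap z f = c) : f = 0 := by
  rw [← Γ.carrier_complex] at h
  exact funext fun e => SegComplex.weight_eq_zero_of_wind_eq h ⟨e, ⟨0, Γ.size_pos e⟩⟩

variable [DecidableEq V]

theorem isBalanced_of_mem_ker (hf : f ∈ LinearMap.ker (boundaryMap ℝ Γ.tail Γ.head)) :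
    Γ.complex.IsBalanced fun x => f x.1 := by
  have := Fintype.ofFinite V
  intro g
  have hzero := sum_boundaryMap_mul Γ.tail Γ.head f (g ∘ D.pos)
  simp only [LinearMap.mem_ker.1 hf, Pi.zero_apply, zero_mul, Finset.sum_const_zero] at hzero
  rw [hzero, Fintype.sum_sigma]
  refine Finset.sum_congr rfl fun e _ => ?_
  rw [Function.comp_apply, Function.comp_apply, ← Γ.vertex_zero, ← Γ.vertex_size,
    ← Finset.sum_range_sub (fun k => g (Γ.vertex e k)), Finset.sum_range, Finset.mul_sum]
  rfl

theorem windMap_eq_of_mem_face (hf : f ∈ LinearMap.ker (boundaryMap ℝ Γ.tail Γ.head))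
    {F : Set Plane} (hF : D.IsFace F) {x y : Plane} (hx : x ∈ F) (hy : y ∈ F) :
    Γ.windMap x f = Γ.windMap y f :=
  (Γ.isBalanced_of_mem_ker hf).wind_eq_of_isPreconnected hF.isPreconnected
    (Γ.carrier_complex ▸ hF.subset_compl) hx hy

theorem finrank_ker_boundaryMap_le_encard_faces {F₀ : Set Plane} (hF₀ : D.IsFace F₀) :
    (Module.finrank ℝ (LinearMap.ker (boundaryMap ℝ Γ.tail Γ.head)) : ℕ∞) ≤
      {F | D.IsFace F ∧ F ≠ F₀}.encard := by
  rcases Set.finite_or_infinite {F | D.IsFace F ∧ F ≠ F₀} with hfin | hinf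
  swap
  · rw [hinf.encard_eq]
    exact le_top
  have := hfin.fintype
  choose x hx using fun F : {F | D.IsFace F ∧ F ≠ F₀} => F.2.1.nonempty
  obtain ⟨x₀, hx₀⟩ := hF₀.nonempty
  let diff : LinearMap.ker (boundaryMap ℝ Γ.tail Γ.head) →ₗ[ℝ] {F | D.IsFace F ∧ F ≠ F₀} → ℝ :=
    (LinearMap.pi fun F => Γ.windMap (x F) - Γ.windMap x₀) ∘ₗ Submodule.subtype _
  have hinj : Function.Injective diff := by
    refine (injective_iff_map_eq_zero diff).2 fun ⟨f, hf⟩ hzero => ?_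
    refine Subtype.ext (Γ.eq_zero_of_windMap_eq (c := Γ.windMap x₀ f) fun z hz => ?_)
    have hF : D.IsFace (connectedComponentIn D.carrierᶜ z) := ⟨z, hz, rfl⟩
    have hzF : z ∈ connectedComponentIn D.carrierᶜ z := mem_connectedComponentIn hz
    by_cases hFF₀ : connectedComponentIn D.carrierᶜ z = F₀
    · exact Γ.windMap_eq_of_mem_face hf hF hzF (hFF₀ ▸ hx₀)
    · exact (Γ.windMap_eq_of_mem_face hf hF hzF (hx ⟨_, hF, hFF₀⟩)).trans
        (sub_eq_zero.1 (congrFun hzero ⟨_, hF, hFF₀⟩))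
  have hle := LinearMap.finrank_le_finrank_of_injective hinj
  rw [Module.finrank_fintype_fun_eq_card] at hle
  rw [Set.encard_eq_coe_toFinset_card, Set.toFinset_card]
  exact_mod_cast hle

end Wind

theorem isSaturated_of_isFace {F : Set Plane} (hF : D.IsFace F) :
    IsSaturated Γ.complex.carrier F := by
  rw [Γ.carrier_complex]
  exact hF.isSaturated

/-- The first segment of an edge. -/
def first (e : H.edgeSet) : Σ e, Fin (Γ.size e) := ⟨e, ⟨0, Γ.size_pos e⟩⟩

/-- The midpoint of the first segment of an edge, at which the sides of the edge are inspected. -/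
noncomputable def mid (e : H.edgeSet) : Plane :=
  midpoint ℝ (Γ.complex.source (Γ.first e)) (Γ.complex.target (Γ.first e))

/-- The set `A` lies along the edge `e`, on the side of `e` given by the sign of `σ`. -/
def LiesAlong (A : Set Plane) (e : H.edgeSet) (σ : ℝ) : Prop :=
  A ∈ 𝓝[Γ.complex.half (Γ.first e) σ] Γ.mid e

theorem mid_mem_openSeg (e : H.edgeSet) : Γ.mid e ∈ Γ.complex.openSeg (Γ.first e) :=
  midpoint_mem_openSegment _ _

theorem mid_mem_arc (e : H.edgeSet) : Γ.mid e ∈ D.arc e.1 :=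
  Γ.openSegment_subset_arc e (Γ.size_pos e) (Γ.mid_mem_openSeg e)

variable {Γ} {A B F F' F₀ : Set Plane} {e : H.edgeSet} {σ : ℝ}

theorem LiesAlong.eq (hF : D.IsFace F) (hF' : D.IsFace F') (hσ : σ ≠ 0)
    (h : Γ.LiesAlong F e σ) (h' : Γ.LiesAlong F' e σ) : F = F' := by
  have := mem_closure_iff_nhdsWithin_neBot.1
    (SegComplex.mem_closure_half (Γ.mid_mem_openSeg e) hσ)
  obtain ⟨z, hz, hz'⟩ := Filter.nonempty_of_mem (inter_mem h h')
  exact hF.eq_of_mem hF' hz hz'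

theorem liesAlong_or_compl (hA : IsSaturated Γ.complex.carrier A) (e : H.edgeSet) (σ : ℝ) :
    Γ.LiesAlong A e σ ∨ Γ.LiesAlong Aᶜ e σ :=
  SegComplex.mem_half_or_compl_mem_half hA (Γ.mid_mem_openSeg e) σ

theorem liesAlong_union (hA : IsSaturated Γ.complex.carrier A) :
    Γ.LiesAlong (A ∪ B) e σ ↔ Γ.LiesAlong A e σ ∨ Γ.LiesAlong B e σ := by
  refine ⟨fun h => ?_, Or.rec (mem_of_superset · subset_union_left)
    (mem_of_superset · subset_union_right)⟩
  refine (liesAlong_or_compl hA e σ).imp_right fun hc => ?_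
  filter_upwards [h, hc] with z hz hzA using hz.resolve_left hzA

theorem mem_boundary_iff (hA : IsSaturated Γ.complex.carrier A) :
    e.1 ∈ Γ.boundary A ↔ ¬ (Γ.LiesAlong A e 1 ↔ Γ.LiesAlong A e (-1)) :=
  (Γ.jumps_iff_mem_boundary hA (Γ.first e)).symm.trans
    (SegComplex.jumps_iff hA (Γ.mid_mem_openSeg e))

theorem liesAlong_of_mem_closure (hF : D.IsFace F) (h : Γ.mid e ∈ closure F) :
    Γ.LiesAlong F e 1 ∨ Γ.LiesAlong F e (-1) := by
  have hm := Γ.mid_mem_openSeg e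
  have hsat := Γ.isSaturated_of_isFace hF
  by_contra! hnot
  have hc : Fᶜ ∈ 𝓝[Γ.complex.carrierᶜ] Γ.mid e := by
    rw [SegComplex.nhdsWithin_compl_carrier hm]
    exact ⟨(liesAlong_or_compl hsat e 1).resolve_left hnot.1,
      (liesAlong_or_compl hsat e (-1)).resolve_left hnot.2⟩
  refine compl_notMem_nhdsWithin h self_mem_nhdsWithin ?_
  rw [Γ.carrier_complex] at hc
  exact nhdsWithin_mono _ hF.subset_compl hc

theorem boundary_nonempty (hF : D.IsFace F) (hF₀ : D.IsFace F₀) (hne : F ≠ F₀) :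
    (Γ.boundary F).Nonempty := by
  refine nonempty_iff_ne_empty.2 fun hempty => ?_
  obtain ⟨x, hx⟩ := hF.nonempty
  obtain ⟨x₀, hx₀⟩ := hF₀.nonempty
  have h := Γ.compl_subset_or_disjoint_of_boundary_eq_empty (Γ.isSaturated_of_isFace hF) hempty
  rw [Γ.carrier_complex] at h
  rcases h with h | h
  · exact hne (hF.eq_of_mem hF₀ (h (hF₀.subset_compl hx₀)) hx₀)
  · exact disjoint_left.1 h (hF.subset_compl hx) hx

theorem boundary_union_eq_empty (hF : D.IsFace F) (hF' : D.IsFace F') (hne : F ≠ F')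
    (h : Γ.boundary F = Γ.boundary F') : Γ.boundary (F ∪ F') = ∅ := by
  have hsat := Γ.isSaturated_of_isFace hF
  have hsat' := Γ.isSaturated_of_isFace hF'
  refine eq_empty_iff_forall_notMem.2 fun e he => ?_
  lift e to H.edgeSet using Γ.boundary_subset_edgeSet _ he
  have hiff : e.1 ∈ Γ.boundary F ↔ e.1 ∈ Γ.boundary F' := by rw [h]
  rw [mem_boundary_iff hsat, mem_boundary_iff hsat'] at hiff
  rw [mem_boundary_iff (hsat.union hsat'), liesAlong_union hsat, liesAlong_union hsat] at he
  have hpos : Γ.LiesAlong F e 1 → ¬ Γ.LiesAlong F' e 1 := fun h₁ h₂ =>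
    hne (h₁.eq hF hF' one_ne_zero h₂)
  have hneg : Γ.LiesAlong F e (-1) → ¬ Γ.LiesAlong F' e (-1) := fun h₁ h₂ =>
    hne (h₁.eq hF hF' (neg_ne_zero.2 one_ne_zero) h₂)
  tauto

theorem eq_of_boundary_eq (hF : D.IsFace F) (hF' : D.IsFace F') (hF₀ : D.IsFace F₀)
    (hne : F ≠ F₀) (hne' : F' ≠ F₀) (h : Γ.boundary F = Γ.boundary F') : F = F' := by
  by_contra hFF'
  obtain ⟨x, hx⟩ := hF.nonempty
  obtain ⟨x₀, hx₀⟩ := hF₀.nonempty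
  have hunion := Γ.compl_subset_or_disjoint_of_boundary_eq_empty
    ((Γ.isSaturated_of_isFace hF).union (Γ.isSaturated_of_isFace hF'))
    (boundary_union_eq_empty hF hF' hFF' h)
  rw [Γ.carrier_complex] at hunion
  rcases hunion with hsub | hdisj
  · rcases hsub (hF₀.subset_compl hx₀) with h' | h'
    · exact hne (hF.eq_of_mem hF₀ h' hx₀)
    · exact hne' (hF'.eq_of_mem hF₀ h' hx₀)
  · exact disjoint_left.1 hdisj (hF.subset_compl hx) (.inl hx)

variable (Γ) in
/-- The edges that `A` lies along, on one side or on both. -/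
def contour (A : Set Plane) : Set H.edgeSet := {e | Γ.LiesAlong A e 1 ∨ Γ.LiesAlong A e (-1)}

theorem boundary_subset_image_contour (hA : IsSaturated Γ.complex.carrier A) :
    Γ.boundary A ⊆ (↑) '' Γ.contour A := by
  intro e he
  lift e to H.edgeSet using Γ.boundary_subset_edgeSet A he
  have hside := (mem_boundary_iff hA).1 he
  exact ⟨e, show _ ∨ _ by tauto, rfl⟩

theorem card_filter_mem_contour_le_two {𝓕 : Finset (Set Plane)} (h𝓕 : ∀ F ∈ 𝓕, D.IsFace F)
    (e : H.edgeSet) [DecidablePred fun F => e ∈ Γ.contour F] :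
    (𝓕.filter fun F => e ∈ Γ.contour F).card ≤ 2 := by
  classical
  have hside : ∀ σ : ℝ, σ ≠ 0 → (𝓕.filter fun F => Γ.LiesAlong F e σ).card ≤ 1 := by
    refine fun σ hσ => Finset.card_le_one.2 fun F hF F' hF' => ?_
    rw [Finset.mem_filter] at hF hF'
    exact hF.2.eq (h𝓕 F hF.1) (h𝓕 F' hF'.1) hσ hF'.2
  calc (𝓕.filter fun F => e ∈ Γ.contour F).card
      = (𝓕.filter fun F => Γ.LiesAlong F e 1 ∨ Γ.LiesAlong F e (-1)).card :=
        congrArg Finset.card (Finset.filter_congr fun F _ => Iff.rfl)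
    _ ≤ (𝓕.filter fun F => Γ.LiesAlong F e 1).card +
          (𝓕.filter fun F => Γ.LiesAlong F e (-1)).card := by
        rw [Finset.filter_or]
        exact Finset.card_union_le _ _
    _ ≤ 2 := add_le_add (hside 1 one_ne_zero) (hside (-1) (neg_ne_zero.2 one_ne_zero))

theorem sum_ncard_contour_le {𝓕 : Finset (Set Plane)} (h𝓕 : ∀ F ∈ 𝓕, D.IsFace F) :
    ∑ F ∈ 𝓕, (Γ.contour F).ncard ≤ 2 * H.edgeSet.ncard := by
  classical
  have := Fintype.ofFinite H.edgeSet
  calc ∑ F ∈ 𝓕, (Γ.contour F).ncard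
      = ∑ F ∈ 𝓕, (Finset.univ.bipartiteAbove (fun F e => e ∈ Γ.contour F) F).card :=
        Finset.sum_congr rfl fun F _ => by
          rw [← Set.ncard_coe_finset, Finset.coe_bipartiteAbove]
          simp
    _ = ∑ e, (𝓕.bipartiteBelow (fun F e => e ∈ Γ.contour F) e).card :=
        Finset.sum_card_bipartiteAbove_eq_sum_card_bipartiteBelow _
    _ ≤ Fintype.card H.edgeSet * 2 :=
        Finset.sum_le_card_nsmul _ _ _ fun e _ => card_filter_mem_contour_le_two h𝓕 e
    _ = 2 * H.edgeSet.ncard := by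
        rw [mul_comm, ← Nat.card_eq_fintype_card, Nat.card_coe_set_eq]

theorem sum_ncard_boundary_add_ncard_le {𝓕 : Finset (Set Plane)} (hF₀ : D.IsFace F₀)
    (h𝓕 : ∀ F ∈ 𝓕, D.IsFace F ∧ F ≠ F₀) {T : Set (Sym2 V)} (hT : T ⊆ H.edgeSet)
    (hTF₀ : ∀ e ∈ T, D.arc e ⊆ closure F₀) :
    ∑ F ∈ 𝓕, (Γ.boundary F).ncard + T.ncard ≤ 2 * H.edgeSet.ncard := by
  classical
  have hcontour : T ⊆ (↑) '' Γ.contour F₀ := by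
    intro e he
    lift e to H.edgeSet using hT he
    exact ⟨e, liesAlong_of_mem_closure hF₀ (hTF₀ e he (Γ.mid_mem_arc e)), rfl⟩
  have hle : ∀ {S : Set (Sym2 V)} {A}, S ⊆ (↑) '' Γ.contour A → S.ncard ≤ (Γ.contour A).ncard :=
    fun h => (Set.ncard_le_ncard h).trans (Set.ncard_image_le)
  calc ∑ F ∈ 𝓕, (Γ.boundary F).ncard + T.ncard
      ≤ ∑ F ∈ 𝓕, (Γ.contour F).ncard + (Γ.contour F₀).ncard :=
        add_le_add (Finset.sum_le_sum fun F hF => hle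
          (boundary_subset_image_contour (Γ.isSaturated_of_isFace (h𝓕 F hF).1))) (hle hcontour)
    _ = ∑ F ∈ insert F₀ 𝓕, (Γ.contour F).ncard := by
        rw [Finset.sum_insert fun h => (h𝓕 F₀ h).2 rfl, add_comm]
    _ ≤ 2 * H.edgeSet.ncard :=
        sum_ncard_contour_le (Finset.forall_mem_insert _ _ _ |>.2 ⟨hF₀, fun F hF => (h𝓕 F hF).1⟩)

end Polygonization

theorem PlaneDrawing.IsFace.exists_faces_ne [Finite V] [Nonempty V] {F₀ : Set Plane}
    (hF₀ : D.IsFace F₀) :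
    ∃ 𝓕 : Finset (Set Plane), (∀ F ∈ 𝓕, D.IsFace F ∧ F ≠ F₀) ∧
      H.edgeSet.ncard + 1 ≤ 𝓕.card + Nat.card V := by
  classical
  obtain ⟨Γ⟩ := exists_polygonization D
  have := Fintype.ofFinite V
  have := Fintype.ofFinite H.edgeSet
  obtain ⟨T, hT, hcard⟩ :=
    Set.exists_subset_encard_eq (Γ.finrank_ker_boundaryMap_le_encard_faces hF₀)
  have hfin := Set.finite_of_encard_eq_coe hcard
  lift T to Finset (Set Plane) using hfin
  rw [Set.encard_coe_eq_coe_finsetCard, Nat.cast_inj] at hcard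
  have hdim := card_add_one_le_finrank_ker_boundaryMap (K := ℝ) Γ.tail Γ.head
  refine ⟨T, fun F hF => hT hF, ?_⟩
  rwa [hcard, ← Nat.card_coe_set_eq, Nat.card_eq_fintype_card, Nat.card_eq_fintype_card]

/-- The members of `𝓑` are the sets of boundary edges of faces other than `F₀`, and the lower bound
on their number is Euler's inequality. -/
theorem PlaneDrawing.exists_boundaries [Finite V] [Nonempty V] (D : PlaneDrawing H)
    {F₀ : Set Plane} (hF₀ : D.IsFace F₀) {T : Set (Sym2 V)} (hT : T ⊆ H.edgeSet)
    (hTF₀ : ∀ e ∈ T, D.arc e ⊆ closure F₀) :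
    ∃ 𝓑 : Finset (Set (Sym2 V)),
      (∀ B ∈ 𝓑, B ⊆ H.edgeSet ∧ B.Nonempty ∧ IsLeafless B) ∧
      H.edgeSet.ncard + 1 ≤ 𝓑.card + Nat.card V ∧
      ∑ B ∈ 𝓑, B.ncard + T.ncard ≤ 2 * H.edgeSet.ncard := by
  classical
  obtain ⟨Γ⟩ := exists_polygonization D
  obtain ⟨𝓕, h𝓕, hcard⟩ := hF₀.exists_faces_ne
  have hinj : Set.InjOn Γ.boundary 𝓕 := fun F hF F' hF' =>
    Polygonization.eq_of_boundary_eq (h𝓕 F hF).1 (h𝓕 F' hF').1 hF₀ (h𝓕 F hF).2 (h𝓕 F' hF').2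
  refine ⟨𝓕.image Γ.boundary, Finset.forall_mem_image.2 fun F hF => ?_, ?_, ?_⟩
  · exact ⟨Γ.boundary_subset_edgeSet F,
      Polygonization.boundary_nonempty (h𝓕 F hF).1 hF₀ (h𝓕 F hF).2,
      Γ.isLeafless_boundary (Γ.isSaturated_of_isFace (h𝓕 F hF).1)⟩
  · rwa [Finset.card_image_of_injOn hinj]
  · rw [Finset.sum_image hinj]
    exact Polygonization.sum_ncard_boundary_add_ncard_le hF₀ h𝓕 hT hTF₀

section Circuits

variable {V : Type*} {G H : SimpleGraph V}

theorem exists_isPath_length_of_forall_exists_adj {a b : V} (hab : H.Adj a b)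
    (hH : ∀ v w, H.Adj v w → ∃ x, x ≠ v ∧ H.Adj w x) (hac : H.IsAcyclic) (n : ℕ) :
    ∃ (u v : V) (p : H.Walk u v), p.IsPath ∧ p.length = n + 1 := by
  induction n with
  | zero => exact ⟨a, b, .cons hab .nil, by simpa using hab.ne, rfl⟩
  | succ n ih =>
    obtain ⟨u, v, p, hp, hlen⟩ := ih
    have hnil : ¬ p.Nil := fun h => by simp [SimpleGraph.Walk.length_eq_zero_iff.2 h] at hlen
    obtain ⟨x, hx, hvx⟩ := hH _ _ (p.adj_penultimate hnil)
    exact ⟨u, x, p.concat hvx,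
      hp.concat (fun hmem => hx (hac.eq_penultimate_of_adj_end hp hvx hmem)) hvx, by simp [hlen]⟩

theorem not_isAcyclic_of_forall_exists_adj [Finite V] {a b : V} (hab : H.Adj a b)
    (hH : ∀ v w, H.Adj v w → ∃ x, x ≠ v ∧ H.Adj w x) : ¬ H.IsAcyclic := by
  have := Fintype.ofFinite V
  intro hac
  obtain ⟨u, v, p, hp, hlen⟩ :=
    exists_isPath_length_of_forall_exists_adj hab hH hac (Fintype.card V)
  have := hp.length_lt
  omega

theorem IsLeafless.exists_isCycle [Finite V] {B : Set (Sym2 V)} (hB : IsLeafless B)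
    (hBG : B ⊆ G.edgeSet) (hne : B.Nonempty) :
    ∃ (a : V) (c : G.Walk a a), c.IsCycle ∧ c.edgeSet ⊆ B := by
  have hle : SimpleGraph.fromEdgeSet B ≤ G :=
    (SimpleGraph.fromEdgeSet_le G).2 fun e he => hBG he.1
  have hadj : ∀ v w, (SimpleGraph.fromEdgeSet B).Adj v w ↔ s(v, w) ∈ B := fun v w =>
    (SimpleGraph.fromEdgeSet_adj B).trans (and_iff_left_of_imp fun h => G.ne_of_adj (hBG h))
  have hcyc : ¬ (SimpleGraph.fromEdgeSet B).IsAcyclic := by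
    obtain ⟨⟨a, b⟩, hab⟩ := hne
    refine not_isAcyclic_of_forall_exists_adj ((hadj a b).2 hab) fun v w hvw => ?_
    obtain ⟨_, hx, hne, x, rfl⟩ := hB _ ((hadj v w).1 hvw) w (Sym2.mem_mk_right v w)
    exact ⟨x, fun h => hne (h ▸ Sym2.eq_swap), (hadj w x).2 hx⟩
  simp only [SimpleGraph.IsAcyclic, not_forall, not_not] at hcyc
  obtain ⟨a, c, hc⟩ := hcyc
  refine ⟨a, c.mapLe hle, hc.mapLe hle, fun e he => ?_⟩
  rw [SimpleGraph.Walk.edgeSet_mapLe_eq_edgeSet] at he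
  have := c.edges_subset_edgeSet he
  rw [SimpleGraph.edgeSet_fromEdgeSet] at this
  exact this.1

theorem five_le_length_of_isCycle (hgirth : 5 ≤ G.egirth) {a : V} {c : G.Walk a a}
    (hc : c.IsCycle) : 5 ≤ c.length :=
  mod_cast SimpleGraph.le_egirth.1 hgirth a c hc

theorem ncard_edgeSet_of_isCycle {a : V} {c : G.Walk a a} (hc : c.IsCycle) :
    c.edgeSet.ncard = c.length := by
  classical
  rw [← c.length_edges, ← List.toFinset_card_of_nodup hc.edges_nodup, ← Set.ncard_coe_finset,
    List.coe_toFinset]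
  rfl

theorem IsLeafless.five_le_ncard [Finite V] (hgirth : 5 ≤ G.egirth) {B : Set (Sym2 V)}
    (hB : IsLeafless B) (hBG : B ⊆ G.edgeSet) (hne : B.Nonempty) : 5 ≤ B.ncard := by
  obtain ⟨a, c, hc, hcB⟩ := hB.exists_isCycle hBG hne
  calc 5 ≤ c.length := five_le_length_of_isCycle hgirth hc
    _ = c.edgeSet.ncard := (ncard_edgeSet_of_isCycle hc).symm
    _ ≤ B.ncard := ncard_le_ncard hcB B.toFinite

theorem IsLeafless.exists_isPentagon [Finite V] (hgirth : 5 ≤ G.egirth) {B : Set (Sym2 V)}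
    (hB : IsLeafless B) (hBG : B ⊆ G.edgeSet) (hcard : B.ncard = 5) :
    ∃ P : G.Subgraph, IsPentagon G P ∧ P.edgeSet = B := by
  have hne : B.Nonempty := nonempty_of_ncard_ne_zero (by omega)
  obtain ⟨a, c, hc, hcB⟩ := hB.exists_isCycle hBG hne
  have hlen := five_le_length_of_isCycle hgirth hc
  rw [← ncard_edgeSet_of_isCycle hc] at hlen
  have heq : c.edgeSet = B := eq_of_subset_of_ncard_le hcB (hcard ▸ hlen) B.toFinite
  refine ⟨c.toSubgraph, ⟨a, c, hc, ?_, rfl⟩, by rw [c.edgeSet_toSubgraph, heq]⟩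
  rw [← ncard_edgeSet_of_isCycle hc, heq, hcard]

/-- The pentagons of `G` whose edges outside the subgraph `H` are precisely those in `T`. For
distinct sets `T` these families of pentagons are disjoint. -/
def pentagonsThrough (G H : SimpleGraph V) (T : Set (Sym2 V)) : Set G.Subgraph :=
  {P | IsPentagon G P ∧ P.edgeSet \ H.edgeSet = T}

theorem six_le_length_add_ncard_pentagonsThrough [Finite V] (hgirth : 5 ≤ G.egirth) {a : V}
    {c : G.Walk a a} (hc : c.IsCycle) :
    6 ≤ c.length + (pentagonsThrough G H (c.edgeSet \ H.edgeSet)).ncard := by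
  rcases (five_le_length_of_isCycle hgirth hc).eq_or_lt with hlen | hlen
  · have hP : c.toSubgraph ∈ pentagonsThrough G H (c.edgeSet \ H.edgeSet) :=
      ⟨⟨a, c, hc, hlen.symm, rfl⟩, by rw [c.edgeSet_toSubgraph]⟩
    have := (ncard_pos (toFinite _)).2 ⟨_, hP⟩
    omega
  · omega

end Circuits

section Chords

variable {V : Type*} {G H : SimpleGraph V}

theorem exists_isPath_of_forall_adj {x : ℕ → V} {i j : ℕ} (hij : i ≤ j)
    (hadj : ∀ k ∈ Ico i j, H.Adj (x k) (x (k + 1))) (hinj : InjOn x (Icc i j)) :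
    ∃ p : H.Walk (x i) (x j), p.IsPath ∧ i + p.length = j ∧ ∀ v ∈ p.support, v ∈ x '' Icc i j := by
  induction j, hij using Nat.le_induction with
  | base => exact ⟨.nil, .nil, rfl, by simp⟩
  | succ j hij ih =>
    have hsub : Icc i j ⊆ Icc i (j + 1) := Icc_subset_Icc_right j.le_succ
    obtain ⟨p, hp, hlen, hsupp⟩ := ih (fun k hk => hadj k ⟨hk.1, hk.2.trans j.lt_succ_self⟩)
      (hinj.mono hsub)
    have hlast : x (j + 1) ∉ p.support := fun hmem => by
      obtain ⟨k, hk, hxk⟩ := hsupp _ hmem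
      have := hinj (hsub hk) ⟨hij.trans j.le_succ, le_rfl⟩ hxk
      have := hk.2
      omega
    refine ⟨p.concat (hadj j ⟨hij, j.lt_succ_self⟩), hp.concat hlast _, ?_, fun v hv => ?_⟩
    · rw [SimpleGraph.Walk.length_concat]
      omega
    · rw [SimpleGraph.Walk.support_concat, List.mem_append,
        List.mem_singleton] at hv
      rcases hv with hv | rfl
      · exact image_mono hsub (hsupp v hv)
      · exact ⟨j + 1, ⟨hij.trans j.le_succ, le_rfl⟩, rfl⟩

theorem exists_isPath_getVert {a : V} {C : H.Walk a a} (hC : C.IsCycle) {i j : ℕ} (hij : i ≤ j)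
    (hj : j < C.length) :
    ∃ p : H.Walk (C.getVert i) (C.getVert j), p.IsPath ∧ i + p.length = j ∧
      ∀ v ∈ p.support, v ∈ C.getVert '' Icc i j :=
  exists_isPath_of_forall_adj hij (fun k hk => C.adj_getVert_succ (hk.2.trans hj)) <|
    hC.getVert_injOn'.mono fun k hk => by
      have := hk.2
      change k ≤ C.length - 1
      omega

theorem exists_isCycle_of_isPath {u v : V} {p : G.Walk u v} (hp : p.IsPath) (huv : G.Adj u v)
    (hmem : s(u, v) ∉ p.edgeSet) :
    ∃ c : G.Walk u u, c.IsCycle ∧ c.length = p.length + 1 ∧ c.edgeSet = insert s(u, v) p.edgeSet :=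
  ⟨.cons huv p.reverse,
    (SimpleGraph.Walk.cons_isCycle_iff _ _).2 ⟨hp.reverse, by simpa using hmem⟩, by simp, by simp⟩

theorem exists_isCycle_of_chord (hHG : H ≤ G) {u v : V} {p : H.Walk u v} (hp : p.IsPath)
    (he : s(u, v) ∈ G.edgeSet \ H.edgeSet) :
    ∃ c : G.Walk u u, c.IsCycle ∧ c.length = p.length + 1 ∧ c.edgeSet \ H.edgeSet = {s(u, v)} := by
  have hpH : p.edgeSet ⊆ H.edgeSet := fun e he => p.edges_subset_edgeSet he
  obtain ⟨c, hc, hlen, hedge⟩ := exists_isCycle_of_isPath (hp.mapLe hHG) he.1 fun hmem =>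
    he.2 (hpH (p.edgeSet_mapLe_eq_edgeSet hHG ▸ hmem))
  rw [SimpleGraph.Walk.edgeSet_mapLe_eq_edgeSet] at hedge
  refine ⟨c, hc, by simpa using hlen, ?_⟩
  rw [hedge, insert_sdiff_of_notMem _ he.2, sdiff_eq_empty.2 hpH, insert_empty_eq]

theorem isPath_append_cons {u v w x : V} {p : G.Walk u v} {q : G.Walk w x} (hp : p.IsPath)
    (hq : q.IsPath) (hpq : p.support.Disjoint q.support) (hvw : G.Adj v w) :
    (p.append (.cons hvw q)).IsPath := by
  rw [SimpleGraph.Walk.isPath_def, SimpleGraph.Walk.support_append,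
    SimpleGraph.Walk.support_cons, List.tail_cons]
  exact hp.support_nodup.append hq.support_nodup hpq

theorem exists_isCycle_of_two_chords (hHG : H ≤ G) {u v w x : V} {p : H.Walk u v} {q : H.Walk w x}
    (hp : p.IsPath) (hq : q.IsPath) (hpq : p.support.Disjoint q.support)
    (he : s(u, w) ∈ G.edgeSet \ H.edgeSet) (hf : s(v, x) ∈ G.edgeSet \ H.edgeSet) (huv : u ≠ v) :
    ∃ c : G.Walk u u, c.IsCycle ∧ c.length = p.length + q.length + 2 ∧
      c.edgeSet \ H.edgeSet = {s(u, w), s(v, x)} := by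
  have hpqH : p.edgeSet ∪ q.edgeSet ⊆ H.edgeSet :=
    union_subset (fun e he => p.edges_subset_edgeSet he) fun e he => q.edges_subset_edgeSet he
  have hvx : G.Adj v x := hf.1
  have hr := isPath_append_cons (hp.mapLe hHG) (hq.reverse.mapLe hHG) (by simpa using hpq) hvx
  have hredge : ((p.mapLe hHG).append (.cons hvx (q.reverse.mapLe hHG))).edgeSet =
      insert s(v, x) (p.edgeSet ∪ q.edgeSet) := by
    simp only [SimpleGraph.Walk.edgeSet_append, SimpleGraph.Walk.edgeSet_cons,
      SimpleGraph.Walk.edgeSet_mapLe_eq_edgeSet, SimpleGraph.Walk.edgeSet_reverse, union_insert]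
  have hne : s(u, w) ≠ s(v, x) := fun h => by
    rcases Sym2.mem_iff.1 (h ▸ Sym2.mem_mk_left u w) with h | rfl
    · exact huv h
    · exact hpq p.start_mem_support q.end_mem_support
  obtain ⟨c, hc, hlen, hedge⟩ := exists_isCycle_of_isPath hr he.1 fun hmem =>
    (mem_insert_iff.1 (hredge ▸ hmem)).elim hne fun h => he.2 (hpqH h)
  refine ⟨c, hc, ?_, ?_⟩
  · simp only [SimpleGraph.Walk.length_append, SimpleGraph.Walk.length_cons,
      SimpleGraph.Walk.length_map, SimpleGraph.Walk.length_reverse] at hlen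
    omega
  · rw [hedge, hredge, insert_sdiff_of_notMem _ he.2, insert_sdiff_of_notMem _ hf.2,
      sdiff_eq_empty.2 hpqH, insert_empty_eq]

theorem add_five_le_of_chord [Finite V] (hHG : H ≤ G) (hgirth : 5 ≤ G.egirth) {a : V}
    {C : H.Walk a a} (hC : C.IsCycle) {i k : ℕ} (hik : i < k) (hk : k < C.length)
    (he : s(C.getVert i, C.getVert k) ∈ G.edgeSet \ H.edgeSet) :
    i + 5 ≤ k + (pentagonsThrough G H {s(C.getVert i, C.getVert k)}).ncard := by
  obtain ⟨p, hp, hlen, -⟩ := exists_isPath_getVert hC hik.le hk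
  obtain ⟨c, hc, hclen, hcH⟩ := exists_isCycle_of_chord hHG hp he
  have := hcH ▸ six_le_length_add_ncard_pentagonsThrough (H := H) hgirth hc
  omega

theorem add_add_four_le_of_crossing_chords [Finite V] (hHG : H ≤ G) (hgirth : 5 ≤ G.egirth) {a : V}
    {C : H.Walk a a} (hC : C.IsCycle) {i j k l : ℕ} (hij : i < j) (hjk : j < k) (hkl : k < l)
    (hl : l < C.length) (he : s(C.getVert i, C.getVert k) ∈ G.edgeSet \ H.edgeSet)
    (hf : s(C.getVert j, C.getVert l) ∈ G.edgeSet \ H.edgeSet) :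
    i + k + 4 ≤ j + l + (pentagonsThrough G H
      {s(C.getVert i, C.getVert k), s(C.getVert j, C.getVert l)}).ncard := by
  obtain ⟨p, hp, hplen, hpsupp⟩ := exists_isPath_getVert hC hij.le (hjk.trans (hkl.trans hl))
  obtain ⟨q, hq, hqlen, hqsupp⟩ := exists_isPath_getVert hC hkl.le hl
  have hpq : p.support.Disjoint q.support := fun v hvp hvq => by
    obtain ⟨m, hm, rfl⟩ := hpsupp v hvp
    obtain ⟨n, hn, hmn⟩ := hqsupp _ hvq
    simp only [mem_Icc] at hm hn
    have := hC.getVert_injOn' (show n ≤ C.length - 1 by omega) (show m ≤ C.length - 1 by omega) hmn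
    omega
  have hne : C.getVert i ≠ C.getVert j := fun h => hij.ne <|
    hC.getVert_injOn' (show i ≤ C.length - 1 by omega) (show j ≤ C.length - 1 by omega) h
  obtain ⟨c, hc, hclen, hcH⟩ := exists_isCycle_of_two_chords hHG hp hq hpq he hf hne
  have := hcH ▸ six_le_length_add_ncard_pentagonsThrough (H := H) hgirth hc
  omega

/-- The three circuits formed by the chords have total length `2 (l - i) + 4`. -/
theorem add_seven_le_of_crossing_chords [Finite V] (hHG : H ≤ G) (hgirth : 5 ≤ G.egirth) {a : V}
    {C : H.Walk a a} (hC : C.IsCycle) {i j k l : ℕ} (hij : i < j) (hjk : j < k) (hkl : k < l)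
    (hl : l < C.length) {e f : Sym2 V} (he : e = s(C.getVert i, C.getVert k))
    (hf : f = s(C.getVert j, C.getVert l)) (heGH : e ∈ G.edgeSet \ H.edgeSet)
    (hfGH : f ∈ G.edgeSet \ H.edgeSet) :
    i + 7 ≤ l + ((pentagonsThrough G H {e}).ncard + (pentagonsThrough G H {f}).ncard +
      (pentagonsThrough G H {e, f}).ncard) := by
  subst he hf
  have h₁ := add_five_le_of_chord hHG hgirth hC (hij.trans hjk) (hkl.trans hl) heGH
  have h₂ := add_five_le_of_chord hHG hgirth hC (hjk.trans hkl) hl hfGH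
  have h₃ := add_add_four_le_of_crossing_chords hHG hgirth hC hij hjk hkl hl heGH hfGH
  omega

end Chords

theorem PlaneDrawing.length_add_four_mul_ncard_edgeSet_add_six_le {V : Type*} [Finite V]
    {G H : SimpleGraph V} (hHG : H ≤ G) (hgirth : 5 ≤ G.egirth) (D : PlaneDrawing H) {a : V}
    {C : H.Walk a a} (hC : C.IsCycle) (hD : D.OuterFaceBoundedBy C) :
    C.length + 4 * H.edgeSet.ncard + 6 ≤
      6 * Nat.card V + (pentagonsThrough G H ∅).ncard := by
  classical
  have : Nonempty V := ⟨a⟩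
  obtain ⟨F₀, hF₀, -, hfrontier⟩ := hD
  obtain ⟨𝓑, h𝓑, hEuler, hsum⟩ := D.exists_boundaries hF₀
    (show C.edgeSet ⊆ H.edgeSet from fun e he => C.edges_subset_edgeSet he)
    fun e he => (subset_biUnion_of_mem (u := D.arc) he).trans
      (hfrontier ▸ frontier_subset_closure)
  have hBG : ∀ B ∈ 𝓑, B ⊆ G.edgeSet := fun B hB =>
    (h𝓑 B hB).1.trans (SimpleGraph.edgeSet_subset_edgeSet.2 hHG)
  have hpent : (𝓑.filter fun B => B.ncard = 5).card ≤ (pentagonsThrough G H ∅).ncard := by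
    rw [← ncard_coe_finset]
    refine (ncard_le_ncard (t := SimpleGraph.Subgraph.edgeSet '' pentagonsThrough G H ∅)
      (fun B hB => ?_) (toFinite _)).trans (ncard_image_le (toFinite _))
    obtain ⟨hB𝓑, hcard⟩ := Finset.mem_filter.1 hB
    obtain ⟨P, hP, rfl⟩ := (h𝓑 B hB𝓑).2.2.exists_isPentagon hgirth (hBG B hB𝓑) hcard
    exact ⟨P, ⟨hP, sdiff_eq_empty.2 (h𝓑 _ hB𝓑).1⟩, rfl⟩
  have hsix : 6 * 𝓑.card ≤ ∑ B ∈ 𝓑, B.ncard + (𝓑.filter fun B => B.ncard = 5).card := by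
    rw [Finset.card_filter, ← Finset.sum_add_distrib, mul_comm, ← smul_eq_mul]
    refine Finset.card_nsmul_le_sum _ _ _ fun B hB => ?_
    have := (h𝓑 B hB).2.2.five_le_ncard hgirth (hBG B hB) (h𝓑 B hB).2.1
    split_ifs <;> omega
  rw [ncard_edgeSet_of_isCycle hC] at hsum
  omega

section Counting

variable {V : Type*} {G H : SimpleGraph V}

theorem sum_ncard_pentagonsThrough_le [Finite V] (𝓣 : Finset (Set (Sym2 V))) :
    ∑ T ∈ 𝓣, (pentagonsThrough G H T).ncard ≤ {P : G.Subgraph | IsPentagon G P}.ncard := by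
  rw [← finsum_mem_coe_finset, ← 𝓣.finite_toSet.ncard_biUnion (fun _ _ => toFinite _)
    fun T _ T' _ hTT' => disjoint_left.2 fun P hP hP' => hTT' (hP.2.symm.trans hP'.2)]
  exact ncard_le_ncard (iUnion₂_subset fun T _ P hP => hP.1) (toFinite _)

theorem sum_ncard_pentagonsThrough_image_le [Finite V] {ι : Type*} {e : ι → Sym2 V}
    (he : Function.Injective e) (𝓣 : Finset (Finset ι)) :
    ∑ t ∈ 𝓣, (pentagonsThrough G H (e '' t)).ncard ≤
      {P : G.Subgraph | IsPentagon G P}.ncard := by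
  classical
  have hinj : Function.Injective fun t : Finset ι => e '' t :=
    he.image_injective.comp Finset.coe_injective
  rw [← Finset.sum_image (f := fun T => (pentagonsThrough G H T).ncard) hinj.injOn]
  exact sum_ncard_pentagonsThrough_le _

theorem sum_ncard_pentagonsThrough_crossing_le [Finite V] {e : Fin 4 → Sym2 V}
    (he : Function.Injective e) :
    (pentagonsThrough G H ∅).ncard + ((pentagonsThrough G H {e 0}).ncard +
      (pentagonsThrough G H {e 1}).ncard + (pentagonsThrough G H {e 0, e 1}).ncard) +
      ((pentagonsThrough G H {e 2}).ncard + (pentagonsThrough G H {e 3}).ncard +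
        (pentagonsThrough G H {e 2, e 3}).ncard) ≤ {P : G.Subgraph | IsPentagon G P}.ncard := by
  have h := sum_ncard_pentagonsThrough_image_le (G := G) (H := H) he
    {∅, {0}, {1}, {0, 1}, {2}, {3}, {2, 3}}
  rw [Finset.sum_insert (by decide), Finset.sum_insert (by decide), Finset.sum_insert (by decide),
    Finset.sum_insert (by decide), Finset.sum_insert (by decide), Finset.sum_insert (by decide),
    Finset.sum_singleton] at h
  simp only [Finset.coe_empty, Finset.coe_singleton, Finset.coe_insert, image_empty,
    image_singleton, image_insert_eq] at h
  omega

theorem ncard_edgeSet_deleteEdges_range_add_card [Finite V] {ι : Type*} [Fintype ι]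
    {e : ι → Sym2 V} (he : Function.Injective e) (heG : ∀ i, e i ∈ G.edgeSet) :
    (G.deleteEdges (range e)).edgeSet.ncard + Fintype.card ι = G.edgeSet.ncard := by
  rw [SimpleGraph.edgeSet_deleteEdges, ← Nat.card_eq_fintype_card, ← ncard_range_of_injective he,
    ncard_sdiff_add_ncard_of_subset (range_subset_iff.2 heG)]

theorem exists_strictMono_getVert_eq {a b : V} {p : G.Walk a b} {l : List V}
    (hl : l.Sublist p.support) :
    ∃ i : Fin l.length → ℕ, StrictMono i ∧ (∀ m, i m ≤ p.length) ∧
      ∀ m, p.getVert (i m) = l[m] := by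
  obtain ⟨f, hf⟩ := List.sublist_iff_exists_orderEmbedding_getElem?_eq.1 hl
  have hget : ∀ m : Fin l.length, p.support[f m]? = some l[m] := fun m => by
    rw [← hf m]
    exact List.getElem?_eq_getElem m.2
  have hle : ∀ m : Fin l.length, f m ≤ p.length := fun m => by
    have := (List.getElem?_eq_some_iff.1 (hget m)).1
    rw [p.length_support] at this
    omega
  refine ⟨fun m => f m, fun m n hmn => f.lt_iff_lt.2 hmn, hle, fun m => ?_⟩
  exact Option.some.inj ((p.getVert_eq_support_getElem? (hle m)).trans (hget m))

theorem crossing_edges_injective {u v : Fin 4 → V}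
    (h : [u 0, u 1, v 0, v 1, u 2, u 3, v 2, v 3].Nodup) :
    Function.Injective fun i => s(u i, v i) := by
  simp only [List.nodup_cons, List.mem_cons, List.not_mem_nil, or_false, not_or] at h
  intro a b hab
  simp only [Sym2.eq_iff] at hab
  fin_cases a <;> fin_cases b <;> grind

theorem two_mul_ncard_edgeSet_of_isRegularOfDegree [Fintype V] [DecidableRel G.Adj] {k : ℕ}
    (hG : G.IsRegularOfDegree k) : 2 * G.edgeSet.ncard = k * Nat.card V := by
  classical
  rw [← SimpleGraph.coe_edgeFinset, ncard_coe_finset, ← G.sum_degrees_eq_twice_card_edges,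
    Finset.sum_congr rfl fun v _ => hG.degree_eq v, Finset.sum_const, Finset.card_univ,
    smul_eq_mul, mul_comm, Nat.card_eq_fintype_card]

theorem sixteen_le_length_add_ncard_pentagonsThrough [Finite V] (hHG : H ≤ G)
    (hgirth : 5 ≤ G.egirth) {u v : Fin 4 → V} {e : Fin 4 → Sym2 V} (he : ∀ i, e i = s(u i, v i))
    (heGH : ∀ i, e i ∈ G.edgeSet \ H.edgeSet)
    (hnodup : [u 0, u 1, v 0, v 1, u 2, u 3, v 2, v 3].Nodup) {C : H.Walk (u 0) (u 0)}
    (hC : C.IsCycle) (hsub : [u 0, u 1, v 0, v 1, u 2, u 3, v 2, v 3].Sublist C.support) :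
    16 ≤ C.length + ((pentagonsThrough G H {e 0}).ncard + (pentagonsThrough G H {e 1}).ncard +
      (pentagonsThrough G H {e 0, e 1}).ncard) + ((pentagonsThrough G H {e 2}).ncard +
        (pentagonsThrough G H {e 3}).ncard + (pentagonsThrough G H {e 2, e 3}).ncard) := by
  obtain ⟨i, hi, hle, hget⟩ := exists_strictMono_getVert_eq hsub
  have hlast : i 7 < C.length := by
    refine (hle 7).lt_of_ne fun h => ?_
    have h7 : v 3 = u 0 := by
      rw [← C.getVert_length, ← h]
      exact (hget 7).symm
    simp [h7] at hnodup
  have hlt : ∀ m n : Fin 8, m < n → i m < i n := fun m n hmn => hi hmn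
  have hpos : ∀ (j : Fin 4) (m n : Fin 8), u j = [u 0, u 1, v 0, v 1, u 2, u 3, v 2, v 3][m] →
      v j = [u 0, u 1, v 0, v 1, u 2, u 3, v 2, v 3][n] →
      e j = s(C.getVert (i m), C.getVert (i n)) := fun j m n hm hn => by
    rw [he, hm, hn]
    exact congrArg₂ _ (hget m).symm (hget n).symm
  have hleft := add_seven_le_of_crossing_chords hHG hgirth hC (hlt 0 1 (by decide))
    (hlt 1 2 (by decide)) (hlt 2 3 (by decide)) ((hlt 3 7 (by decide)).trans hlast)
    (hpos 0 0 2 rfl rfl) (hpos 1 1 3 rfl rfl) (heGH 0) (heGH 1)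
  have hright := add_seven_le_of_crossing_chords hHG hgirth hC (hlt 4 5 (by decide))
    (hlt 5 6 (by decide)) (hlt 6 7 (by decide)) hlast
    (hpos 2 4 6 rfl rfl) (hpos 3 5 7 rfl rfl) (heGH 2) (heGH 3)
  have := hlt 3 4 (by decide)
  omega

end Counting

end Doublecross

theorem mainTheorem4_general {V : Type*} [Finite V] (G : SimpleGraph V) (hgirth : 5 ≤ G.egirth)
    (hG : Doublecross.IsDoublecross G) :
    4 * G.edgeSet.ncard + 6 ≤
      6 * Nat.card V + Set.ncard {P : G.Subgraph | Doublecross.IsPentagon G P} := by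
  obtain ⟨u, v, huv, hnodup, hdrawing⟩ := hG
  set e : Fin 4 → Sym2 V := fun i => s(u i, v i)
  set H := G.deleteEdges (Set.range e) with hH
  obtain ⟨D, C, hC, hD, hsub⟩ := hdrawing
  have hHG : H ≤ G := G.deleteEdges_le _
  have heinj : Function.Injective e := Doublecross.crossing_edges_injective hnodup
  have heGH : ∀ i, e i ∈ G.edgeSet \ H.edgeSet := fun i =>
    ⟨huv i, fun h => by
      rw [hH, SimpleGraph.edgeSet_deleteEdges] at h
      exact h.2 (Set.mem_range_self i)⟩
  have hedges : H.edgeSet.ncard + Fintype.card (Fin 4) = G.edgeSet.ncard :=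
    Doublecross.ncard_edgeSet_deleteEdges_range_add_card heinj huv
  have hfaces := D.length_add_four_mul_ncard_edgeSet_add_six_le hHG hgirth hC hD
  have hchords := Doublecross.sixteen_le_length_add_ncard_pentagonsThrough hHG hgirth
    (e := e) (fun _ => rfl) heGH hnodup hC hsub
  have hdisjoint := Doublecross.sum_ncard_pentagonsThrough_crossing_le (G := G) (H := H) heinj
  rw [Fintype.card_fin] at hedges
  omega

theorem mainTheorem4 {V : Type*} [Fintype V] (G : SimpleGraph V) [DecidableRel G.Adj]
    (hcubic : G.IsRegularOfDegree 3) (hgirth : 5 ≤ G.egirth)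
    (hG : Doublecross.IsDoublecross G) :
    6 ≤ Set.ncard {P : G.Subgraph | Doublecross.IsPentagon G P} := by
  have hcount := mainTheorem4_general G hgirth hG
  have hedges := Doublecross.two_mul_ncard_edgeSet_of_isRegularOfDegree hcubic
  omega
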